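/- Let $\Gamma\subset SL(2,\mathbf C)$ be a finite subgroup, let $Y_1,\dots,Y_\nu$ be pairwise non-isomorphic irreducible complex representations of $\Gamma$, and let $N_1,\dots,N_\nu\ge 0$ be integers, at least two of which are non-zero; put $N=\sum_h N_h$. Let $\mathbf\Gamma_N=S_N\ltimes\Gamma^N$ be the wreath product. For $\gamma\in\Gamma$ write $\gamma_i$ for the element $\gamma$ in the $i$-th factor of $\Gamma^N$, and $s_{ij}\in S_N$ for the transposition of $i$ and $j$. Let $S_{\vec N}=S_{N_1}\times\dots\times S_{N_\nu}\subset S_N$ be the subgroup permuting the first $N_1$ indices, the next $N_2$ indices, and so on. Let $Y=Y_1^{\otimes N_1}\otimes\dots\otimes Y_\nu^{\otimes N_\nu}$, on which $\Gamma^N$ acts factor by factor and $S_{\vec N}$ by permuting the tensor factors, let $W$ be an irreducible complex representation of $S_{\vec N}$, regarded as a representation of $S_{\vec N}\ltimes\Gamma^N$ on which $\Gamma^N$ acts trivially, and let $$W\otimes Y\uparrow\;=\;\mathrm{Ind}_{S_{\vec N}\ltimes\Gamma^N}^{\mathbf\Gamma_N}(W\otimes Y),$$ an irreducible representation of $\mathbf\Gamma_N$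 of (non-trivial) type $(N_1,\dots,N_\nu)$. Let $k\in\mathbf C$ with $k\neq 0$, and let $c=(c_\gamma)$ be a complex-valued class function on $\Gamma\setminus\{e\}$. Then the operators of $W\otimes Y\uparrow$ satisfy the relations (R1) for all $i\in\{1,\dots,N\}$: $\quad 0=1+\frac k2\sum_{j\ne i}\sum_{\gamma\in\Gamma}s_{ij}\gamma_i\gamma_j^{-1}+\sum_{\gamma\in\Gamma\setminus\{e\}}c_\gamma\gamma_i$ if and only if both of the following conditions hold: i) $W\cong W_1\otimes\dots\otimes W_\nu$, where, for every $h$, $W_h$ is an irreducible representation of $S_{N_h}$ whose Young diagram is a rectangle of some height $a_h$ and width $b_h$ with $a_hb_h=N_h$ (the one-row diagram corresponding to the trivial representation; for $N_h=0$ the group is trivial and the diagram is empty); ii) for every $h$ with $N_h\neq 0$, $$\dim Y_h+(b_h-a_h)\,\frac k2\,|\Gamma|+\sum_{C\neq\{e\}}c_C\,|C|\,\chi_{Y_h}(C)=0,$$ where the sum is over the conjugacy classes $C\ne\{e\}$ of $\Gamma$, and $c_C$ and $\chi_{Y_h}(C)$ are the values on $C$ of $c$ and of the character of $Y_h$. 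-/

import Mathlib

open Equiv
open scoped TensorProduct BigOperators

noncomputable section

namespace WreathR1

/-! ### Irreducible representations of symmetric groups attached to Young diagrams -/

section Specht

variable {α : Type} [Fintype α] [DecidableEq α] {μ : YoungDiagram}

/-- The rectangular Young diagram with `a` rows (height `a`) and `b` columns (width `b`).
Cells are pairs (row, column). -/
def rectDiagram (a b : ℕ) : YoungDiagram where
  cells := Finset.range a ×ˢ Finset.range b
  isLowerSet := by
    rintro ⟨i, j⟩ ⟨i', j'⟩ h hm
    obtain ⟨h1, h2⟩ := Prod.mk_le_mk.mp h
    simp only [Finset.coe_product, Finset.coe_range, Set.mem_prod, Set.mem_Iio] at hm ⊢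
    omega

/-- The permutations of the letters that preserve every row of the tableau `T`. -/
def rowGroup (T : α ≃ {x // x ∈ μ.cells}) : Finset (Perm α) :=
  Finset.univ.filter fun σ => ∀ x, (T (σ x)).1.1 = (T x).1.1

/-- The permutations of the letters that preserve every column of the tableau `T`. -/
def colGroup (T : α ≃ {x // x ∈ μ.cells}) : Finset (Perm α) :=
  Finset.univ.filter fun σ => ∀ x, (T (σ x)).1.2 = (T x).1.2

/-- The Young symmetrizer of the tableau `T`: the row symmetrizer times the column
antisymmetrizer. -/
def youngSymmetrizer (T : α ≃ {x // x ∈ μ.cells}) : MonoidAlgebra ℂ (Perm α) :=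
  (∑ σ ∈ rowGroup T, MonoidAlgebra.of ℂ (Perm α) σ) *
    ∑ σ ∈ colGroup T, ((Perm.sign σ : ℤ) : ℂ) • MonoidAlgebra.of ℂ (Perm α) σ

/-- The left ideal `ℂ[S] c_T` of the group algebra generated by the Young symmetrizer `c_T`. -/
abbrev SpechtModule (T : α ≃ {x // x ∈ μ.cells}) : Ideal (MonoidAlgebra ℂ (Perm α)) :=
  Ideal.span {youngSymmetrizer T}

/-- The irreducible representation `W_μ` of the symmetric group on the letters `α`, realised by left
multiplication on `ℂ[S] c_T`, where `T` is a numbering of the cells of `μ` by the letters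
(different numberings give isomorphic representations).
A single row gives the trivial representation. -/
def spechtRep (T : α ≃ {x // x ∈ μ.cells}) : Representation ℂ (Perm α) (SpechtModule T) :=
  ((Algebra.lsmul ℂ ℂ (SpechtModule T) :
      MonoidAlgebra ℂ (Perm α) →ₐ[ℂ] Module.End ℂ (SpechtModule T)) :
      MonoidAlgebra ℂ (Perm α) →* Module.End ℂ (SpechtModule T)).comp
    (MonoidAlgebra.of ℂ (Perm α))

end Specht

/-- The external tensor product of representations of the groups `G h`, a representation of
the product group. -/
def extTensor {ι : Type} {G : ι → Type} [∀ h, Group (G h)] {U : ι → Type*}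
    [∀ h, AddCommGroup (U h)] [∀ h, Module ℂ (U h)] (ρ : ∀ h, Representation ℂ (G h) (U h)) :
    Representation ℂ (∀ h, G h) (PiTensorProduct ℂ U) where
  toFun g := PiTensorProduct.map fun h => ρ h (g h)
  map_one' := by
    ext v
    simp
  map_mul' g g' := by
    ext v
    simp

/-! ### The wreath product and the relations -/

section Wreath

variable (Γ : Type) [Group Γ]

/-- The wreath product `S_I ⋉ Γ^I`: permutations permute the factors, so that
`(σ • g) i = g (σ⁻¹ i)`. -/
abbrev Wreath (I : Type) : Type :=
  (I → Γ) ⋊[(mulAutArrow : Perm I →* MulAut (I → Γ))] Perm I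

variable {Γ} {I : Type} [DecidableEq I]

/-- `γ_i`: the element `γ` placed in the `i`-th factor of `Γ^I`. -/
def embAt (i : I) (γ : Γ) : Wreath Γ I := SemidirectProduct.inl (Pi.mulSingle i γ)

/-- `s_{ij}`: the transposition of `i` and `j`. -/
def transp (i j : I) : Wreath Γ I := SemidirectProduct.inr (swap i j)

open Classical in
/-- The operators of the representation `ρ` of the wreath product satisfy, for every `i`,
`0 = 1 + (k/2) ∑_{j ≠ i} ∑_{γ ∈ Γ} s_{ij} γ_i γ_j⁻¹ + ∑_{γ ≠ e} c_γ γ_i`.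
The value of `c` at the identity is not used. -/
def SatisfiesR1 [Fintype Γ] [Fintype I] {M : Type*} [AddCommGroup M] [Module ℂ M]
    (ρ : Representation ℂ (Wreath Γ I) M) (k : ℂ) (c : Γ → ℂ) : Prop :=
  ∀ i : I, (0 : Module.End ℂ M) =
    1 + (k / 2) • (∑ j ∈ Finset.univ.filter (fun j : I => j ≠ i), ∑ γ : Γ,
          ρ (transp i j * embAt i γ * (embAt j γ)⁻¹))
      + ∑ γ ∈ Finset.univ.filter (fun γ : Γ => γ ≠ 1), c γ • ρ (embAt i γ)

end Wreath

/-! ### The representations `W ⊗ Y ↑` -/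

section Induced

variable (Γ : Type) [Group Γ] {ν : ℕ} (n : Fin ν → ℕ)

/-- The set `[1, N]`, `N = ∑ n h`, of positions, cut into consecutive blocks of sizes
`n 0, n 1, …`: the pair `⟨h, p⟩` is the `p`-th position of the `h`-th block. -/
abbrev Pos : Type := Σ h : Fin ν, Fin (n h)

/-- The inertia factor `S_{n 0} × S_{n 1} × …`. -/
abbrev InertiaFactor : Type := ∀ h : Fin ν, Perm (Fin (n h))

/-- The embedding of the inertia factor in the symmetric group on all positions. -/
def inertiaFactorHom : InertiaFactor n →* Perm (Pos n) :=
  Perm.sigmaCongrRightHom fun h => Fin (n h)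

/-- The inertia group `(S_{n 0} × S_{n 1} × …) ⋉ Γ^N`. -/
abbrev Inertia : Type :=
  (Pos n → Γ) ⋊[(mulAutArrow : Perm (Pos n) →* MulAut (Pos n → Γ)).comp (inertiaFactorHom n)]
    InertiaFactor n

/-- The embedding of the inertia group in the wreath product. -/
def inertiaHom : Inertia Γ n →* Wreath Γ (Pos n) :=
  SemidirectProduct.map (MonoidHom.id _) (inertiaFactorHom n) fun _ => rfl

variable {Γ} {n} {V : Fin ν → Type*} [∀ h, AddCommGroup (V h)] [∀ h, Module ℂ (V h)]

/-- The underlying space of `Y = Y_0^{⊗ n 0} ⊗ Y_1^{⊗ n 1} ⊗ …`. -/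
abbrev YSpace (n : Fin ν → ℕ) (V : Fin ν → Type*) [∀ h, AddCommGroup (V h)]
    [∀ h, Module ℂ (V h)] : Type _ :=
  PiTensorProduct ℂ fun h : Fin ν => PiTensorProduct ℂ fun _ : Fin (n h) => V h

/-- `Y = Y_0^{⊗ n 0} ⊗ Y_1^{⊗ n 1} ⊗ …` as a representation of the inertia group: the element
`g` of `Γ^N` acts factor by factor, the inertia factor permutes the tensor factors in each block. -/
def yRep (Y : ∀ h, Representation ℂ Γ (V h)) : Representation ℂ (Inertia Γ n) (YSpace n V) where
  toFun x := PiTensorProduct.map fun h =>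
    (PiTensorProduct.map fun p : Fin (n h) => Y h (x.left ⟨h, p⟩)) ∘ₗ
      (PiTensorProduct.reindex ℂ (fun _ : Fin (n h) => V h) (x.right h)).toLinearMap
  map_one' := by
    rw [Module.End.one_eq_id, ← PiTensorProduct.map_id]
    congr 1
    funext h
    ext v
    simp
    rfl
  map_mul' x y := by
    rw [Module.End.mul_eq_comp, ← PiTensorProduct.map_comp]
    congr 1
    funext h
    ext v
    simp [PiTensorProduct.map_tprod, PiTensorProduct.reindex_tprod]
    rfl

/-- `W ⊗ Y` as a representation of the inertia group; `Γ^N` acts trivially on `W`. -/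
def wyRep {U : Type*} [AddCommGroup U] [Module ℂ U] (W : Representation ℂ (InertiaFactor n) U)
    (Y : ∀ h, Representation ℂ Γ (V h)) :
    Representation ℂ (Inertia Γ n) (U ⊗[ℂ] YSpace n V) :=
  Representation.tprod (W.comp SemidirectProduct.rightHom) (yRep Y)

/-- `W ⊗ Y ↑`: the representation of the wreath product induced from `W ⊗ Y`. -/
def wyInd {U : Type*} [AddCommGroup U] [Module ℂ U] (W : Representation ℂ (InertiaFactor n) U)
    (Y : ∀ h, Representation ℂ Γ (V h)) :
    Representation ℂ (Wreath Γ (Pos n))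
      (Representation.IndV (inertiaHom Γ n) (wyRep W Y)) :=
  Representation.ind (inertiaHom Γ n) (wyRep W Y)

end Induced

open Classical in
/-- `(k, c)` lies on the hyperplane
`dim Y + (b - a) (k/2) |Γ| + ∑_{C ≠ {e}} c_C |C| χ_Y(C) = 0`,
the sum being over the conjugacy classes `C` of `Γ` other than `{e}`; the class functions `c` and
`χ_Y` are evaluated at a representative of `C`. -/
def OnHyperplane {Γ : Type} [Group Γ] [Fintype Γ] {V : Type*} [AddCommGroup V] [Module ℂ V]
    (Y : Representation ℂ Γ V) (a b : ℕ) (k : ℂ) (c : Γ → ℂ) : Prop :=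
  (Module.finrank ℂ V : ℂ) + ((b : ℂ) - (a : ℂ)) * (k / 2) * (Fintype.card Γ : ℂ)
    + ∑ C ∈ Finset.univ.filter (fun C : ConjClasses Γ => C ≠ ConjClasses.mk 1),
        c (Quotient.out C) * (Nat.card C.carrier : ℂ) * Y.character (Quotient.out C) = 0

end WreathR1

end

/-! The induced representation is generated by its subspace `W ⊗ Y`. That subspace is stable under
`Γ^N`, and permutations of the positions permute the relation operators, so the relations need only
be tested on `W ⊗ Y` (`satisfiesR1_wyInd_iff`). There, for `i` in block `h`, Schur orthogonality
evaluates every term. If `j` lies in another block, the sum of `γ_i γ_j⁻¹` is zero. If `j` lies in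
the same block, that sum is `|Γ| / dim Y_h` times the flip of the two factors, which `s_ij` undoes,
leaving only a transposition acting on `W`. The class function acts by a scalar. Since `k ≠ 0`, the
relations say that in each block every sum `∑_{q ≠ p} s_pq` acts on `W` by one scalar `l`,
prescribed by `k` and `c` (`satisfiesR1_wyInd_iff_block`).

It remains to see that this happens exactly for rectangles, with `l = b - a`. Classically, such a
sum is conjugate to a Jucys–Murphy element, whose eigenvalues are the contents of the removable
corners, and a diagram with a single corner is a rectangle. The argument here is direct. Let `η =
±1` and take a largest set `R` of letters whose transpositions act by `η` on some nonzero vector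
`u`. Adding a letter and (anti)symmetrizing must give zero, so `∑_{j ∈ R} s_ij u = -η u` for `i ∉
R`. Summing the scalar relation over `R` shows that `m = |R|` satisfies `η l m = m² - |A|`, where
`A` is the set of all letters; this has at most one positive root. On the complement of `R` the
scalar is `l + η` and the root is the same, so one can iterate: the letters split into `b` columns
of one height `a`, and `l = b - a` (`exists_maximal`, `exists_filling`, `exists_rectangle`).

To identify `W`, a column-antisymmetric vector is symmetrized along the rows without being killed
(`exists_symmetrized`), so the Young symmetrizers act nontrivially on `W`. This gives a nonzero map
to `W` from the external product of Specht modules. It is bijective because the product of the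
symmetrizers maps the source onto a generating line (`bijective_of_line`). Conversely,
`swapSumsActBy_spechtRep` computes the scalar on the Specht module of a rectangle. -/

noncomputable section

set_option linter.unusedSectionVars false

namespace WreathR1

/-! ### Vectors on which the sums of transpositions act by scalars -/

section TranspositionSums

variable {α : Type} {M : Type*} [AddCommGroup M] [Module ℂ M]
  {ρ : Representation ℂ (Perm α) M}

lemma rho_mul_apply (g g' : Perm α) (v : M) : ρ (g * g') v = ρ g (ρ g' v) := by
  rw [map_mul, Module.End.mul_apply]

lemma rho_conj (g g' : Perm α) (v : M) : ρ g (ρ g' v) = ρ (g * g' * g⁻¹) (ρ g v) := by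
  rw [← rho_mul_apply, ← rho_mul_apply, inv_mul_cancel_right]

variable [DecidableEq α]

variable (ρ) in
/-- The transpositions of letters of `R` act on `u` by the scalar `η`. -/
def SwapsActBy (η : ℂ) (R : Finset α) (u : M) : Prop :=
  ∀ i ∈ R, ∀ j ∈ R, i ≠ j → ρ (swap i j) u = η • u

variable (ρ) in
/-- For every `i ∈ A`, the sum of the transpositions of `i` with the other letters of `A` acts on
`v` by the scalar `l`. -/
def SwapSumsActBy (A : Finset α) (l : ℂ) (v : M) : Prop :=
  ∀ i ∈ A, ∑ j ∈ A.erase i, ρ (swap i j) v = l • v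

lemma rho_swap_swap (i j : α) (v : M) : ρ (swap i j) (ρ (swap i j) v) = v := by
  rw [← rho_mul_apply, swap_mul_self, map_one, Module.End.one_apply]

lemma rho_swap_conj (g : Perm α) (i j : α) (v : M) :
    ρ g (ρ (swap i j) v) = ρ (swap (g i) (g j)) (ρ g v) := by
  rw [rho_conj, swap_apply_apply]

lemma swap_apply_mem_iff {R : Finset α} {p q : α} (hp : p ∈ R) (hq : q ∈ R) (j : α) :
    swap p q j ∈ R ↔ j ∈ R := by
  rw [swap_apply_def]
  split_ifs with h h'
  · exact iff_of_true hq (h ▸ hp)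
  · exact iff_of_true hp (h' ▸ hq)
  · rfl

/-- Enlarging by one letter the set on which transpositions act by `η`. -/
lemma SwapsActBy.insert_add {η : ℂ} (hη : η * η = 1) {R : Finset α} {u : M}
    (hu : SwapsActBy ρ η R u) {i : α} (hi : i ∉ R) :
    SwapsActBy ρ η (insert i R) (u + η • ∑ j ∈ R, ρ (swap i j) u) := by
  have key : ∀ p ∈ R, ρ (swap i p) (u + η • ∑ j ∈ R, ρ (swap i j) u) =
      η • (u + η • ∑ j ∈ R, ρ (swap i j) u) := by
    intro p hp
    rw [← Finset.add_sum_erase _ _ hp]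
    -- This is `s_ip s_ij = s_ij s_jp`, where `s_jp` already acts on `u` by `η`.
    have h1 : ∀ j ∈ R.erase p, ρ (swap i p) (ρ (swap i j) u) = η • ρ (swap i j) u := by
      intro j hj
      have hjp := Finset.ne_of_mem_erase hj
      have hjR := Finset.mem_of_mem_erase hj
      have hij : j ≠ i := fun h => hi (h ▸ hjR)
      have hpi : p ≠ i := fun h => hi (h ▸ hp)
      have := rho_swap_conj (ρ := ρ) (swap i j) j p u
      rw [swap_apply_right, swap_apply_of_ne_of_ne hpi (Ne.symm hjp), hu j hjR p hp hjp,
        map_smul] at this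
      exact this.symm
    simp only [map_add, map_smul, map_sum, rho_swap_swap]
    rw [Finset.sum_congr rfl h1, ← Finset.smul_sum]
    simp only [smul_add, smul_smul, hη, one_smul]
    abel
  intro p hp q hq hpq
  rcases Finset.mem_insert.1 hp with hp' | hp <;> rcases Finset.mem_insert.1 hq with hq' | hq
  · exact absurd (hp'.trans hq'.symm) hpq
  · rw [hp']
    exact key q hq
  · rw [hq', swap_comm]
    exact key p hp
  · have hpi : i ≠ p := fun h => hi (h ▸ hp)
    have hqi : i ≠ q := fun h => hi (h ▸ hq)
    have h2 : ∀ j ∈ R, ρ (swap p q) (ρ (swap i j) u) = η • ρ (swap i (swap p q j)) u := by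
      intro j _
      rw [rho_swap_conj, swap_apply_of_ne_of_ne hpi hqi, hu p hp q hq hpq, map_smul]
    have h3 : ∑ j ∈ R, ρ (swap i (swap p q j)) u = ∑ j ∈ R, ρ (swap i j) u := by
      refine Finset.sum_equiv (swap p q) (fun j => (swap_apply_mem_iff hp hq j).symm) fun _ _ => rfl
    rw [map_add, map_smul, map_sum, Finset.sum_congr rfl h2, ← Finset.smul_sum, h3,
      hu p hp q hq hpq, smul_add]

lemma SwapSumsActBy.rho_swap {A : Finset α} {l : ℂ} {v : M} (hv : SwapSumsActBy ρ A l v)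
    {p q : α} (hp : p ∈ A) (hq : q ∈ A) : SwapSumsActBy ρ A l (ρ (swap p q) v) := by
  have hmem := swap_apply_mem_iff hp hq
  intro i hi
  rw [← map_smul, ← hv (swap p q i) ((hmem i).2 hi), map_sum]
  refine Finset.sum_equiv (swap p q) (fun j => ?_) fun j _ => ?_
  · simp [hmem]
  · rw [rho_swap_conj (swap p q) (swap p q i), swap_apply_self, swap_apply_self]

lemma SwapSumsActBy.add {A : Finset α} {l : ℂ} {v w : M} (hv : SwapSumsActBy ρ A l v)
    (hw : SwapSumsActBy ρ A l w) : SwapSumsActBy ρ A l (v + w) := by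
  intro i hi
  simp only [map_add, Finset.sum_add_distrib, hv i hi, hw i hi, smul_add]

lemma SwapSumsActBy.smul {A : Finset α} {l : ℂ} {v : M} (hv : SwapSumsActBy ρ A l v) (z : ℂ) :
    SwapSumsActBy ρ A l (z • v) := by
  intro i hi
  simp only [map_smul, ← Finset.smul_sum, hv i hi, smul_comm z l]

variable (ρ) in
/-- The submodule of the vectors on which the sums of transpositions in `A` act by `l`. -/
def swapSumsSubmodule (A : Finset α) (l : ℂ) : Submodule ℂ M where
  carrier := {v | SwapSumsActBy ρ A l v}
  zero_mem' := fun i _ => by simp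
  add_mem' := SwapSumsActBy.add
  smul_mem' z _ hv := SwapSumsActBy.smul hv z

/-- Two positive roots of `m² - L m - N`, `N ≥ 0`, agree. -/
lemma root_unique {L : ℂ} {N m m' : ℕ} (hm : 0 < m)
    (h : L * m = (m : ℂ) ^ 2 - N) (h' : L * m' = (m' : ℂ) ^ 2 - N) (hm' : 0 < m') : m = m' := by
  by_contra hne
  have hne' : (m : ℂ) - m' ≠ 0 := sub_ne_zero.2 (by exact_mod_cast hne)
  have h1 : ((m : ℂ) - m') * (m + m' - L) = 0 := by linear_combination h' - h
  have h2 := (mul_eq_zero.1 h1).resolve_left hne'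
  -- Two distinct roots would have product `-N`, impossible for positive integers.
  have h3 : (N : ℂ) + m * m' = 0 := by linear_combination h + m * h2
  have h4 : N + m * m' = 0 := by exact_mod_cast h3
  have := Nat.mul_pos hm hm'
  omega

/-- A submodule stable under the transpositions of letters of `A`. -/
def SwapStable (ρ : Representation ℂ (Perm α) M) (A : Finset α) (K : Submodule ℂ M) : Prop :=
  ∀ p ∈ A, ∀ q ∈ A, ∀ v ∈ K, ρ (swap p q) v ∈ K

lemma swapStable_swapSumsSubmodule (A : Finset α) (l : ℂ) :
    SwapStable ρ A (swapSumsSubmodule ρ A l) :=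
  fun _ hp _ hq _ hv => SwapSumsActBy.rho_swap hv hp hq

/-- If no vector of `K` has a larger set of letters permuted by `η`, then the partial sums of
transpositions act by `-η`. -/
lemma sum_swap_of_maximal {η : ℂ} (hη : η * η = 1) {A : Finset α} {K : Submodule ℂ M}
    (hK : SwapStable ρ A K) {R : Finset α} (hR : R ⊆ A)
    (hmax : ∀ R' ⊆ A, ∀ u ∈ K, SwapsActBy ρ η R' u → R.card < R'.card → u = 0)
    {u : M} (huK : u ∈ K) (hu : SwapsActBy ρ η R u) {i : α} (hi : i ∈ A) (hiR : i ∉ R) :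
    ∑ j ∈ R, ρ (swap i j) u = -η • u := by
  -- The `η`-symmetrization over `insert i R` lies in `K` and has too many symmetric letters, so it
  -- vanishes.
  have h0 := hmax (insert i R) (Finset.insert_subset hi hR) _
    (K.add_mem huK (K.smul_mem η (K.sum_mem fun j hj => hK i hi j (hR hj) u huK)))
    (hu.insert_add hη hiR) (by rw [Finset.card_insert_of_notMem hiR]; omega)
  have h1 := congrArg (η • ·) (eq_neg_of_add_eq_zero_right h0)
  simp only [smul_smul, hη, one_smul, smul_neg] at h1
  rw [h1, neg_smul]

/-- The maximal number of letters permuted by `η` is the positive root of a quadratic equation. -/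
lemma exists_maximal {η : ℂ} (hη : η * η = 1) {A : Finset α} (hA : A.Nonempty)
    {K : Submodule ℂ M} (hK : SwapStable ρ A K) {l : ℂ} (hl : ∀ v ∈ K, SwapSumsActBy ρ A l v)
    (hne : K ≠ ⊥) :
    ∃ R ⊆ A, R.Nonempty ∧ (∃ u ∈ K, u ≠ 0 ∧ SwapsActBy ρ η R u) ∧
      η * l * R.card = (R.card : ℂ) ^ 2 - A.card ∧
      ∀ R' ⊆ A, ∀ u ∈ K, SwapsActBy ρ η R' u → R.card < R'.card → u = 0 := by
  classical
  obtain ⟨v, hvK, hv0⟩ := K.ne_bot_iff.1 hne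
  obtain ⟨a, ha⟩ := hA
  let S := A.powerset.filter fun R => R.Nonempty ∧ ∃ u ∈ K, u ≠ 0 ∧ SwapsActBy ρ η R u
  have hS : S.Nonempty := by
    -- For a singleton the condition on transpositions is vacuous.
    refine ⟨{a}, Finset.mem_filter.2 ⟨by simpa using ha, by simp, v, hvK, hv0, ?_⟩⟩
    intro i hi j hj hij
    rw [Finset.mem_singleton] at hi hj
    exact absurd (hi.trans hj.symm) hij
  obtain ⟨R, hRS, hRmax⟩ := S.exists_max_image Finset.card hS
  obtain ⟨hRA, hRne, u, huK, hu0, hu⟩ := Finset.mem_filter.1 hRS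
  rw [Finset.mem_powerset] at hRA
  have hmax : ∀ R' ⊆ A, ∀ u ∈ K, SwapsActBy ρ η R' u → R.card < R'.card → u = 0 := by
    intro R' hR' w hw hwR hlt
    by_contra hw0
    have := hRmax R' (Finset.mem_filter.2 ⟨Finset.mem_powerset.2 hR',
      Finset.card_pos.1 (by omega), w, hw, hw0, hwR⟩)
    omega
  refine ⟨R, hRA, hRne, ⟨u, huK, hu0, hu⟩, ?_, hmax⟩
  -- The double sum is computed twice: by the scalar `l`, and by splitting the inner sum into
  -- letters inside and outside `R`.
  have h1 : ∑ i ∈ R, ∑ j ∈ A.erase i, ρ (swap i j) u = (R.card * l) • u := by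
    rw [Finset.sum_congr rfl fun i hi => hl u huK i (hRA hi), Finset.sum_const, ← Nat.cast_smul_eq_nsmul ℂ,
      smul_smul]
  have h2 : ∀ i ∈ R, ∑ j ∈ A.erase i, ρ (swap i j) u =
      ((R.card - 1 : ℂ) * η) • u + ∑ j ∈ A \ R, ρ (swap i j) u := by
    intro i hi
    have hsplit : A.erase i = R.erase i ∪ A \ R := by
      ext x
      simp only [Finset.mem_erase, Finset.mem_union, Finset.mem_sdiff]
      constructor
      · tauto
      · rintro (⟨h, h'⟩ | ⟨h, h'⟩)
        · exact ⟨h, hRA h'⟩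
        · exact ⟨fun e => h' (e ▸ hi), h⟩
    rw [hsplit, Finset.sum_union (by
      rw [Finset.disjoint_left]
      intro x hx hx'
      exact (Finset.mem_sdiff.1 hx').2 (Finset.mem_of_mem_erase hx))]
    congr 1
    rw [Finset.sum_congr rfl fun j hj => hu i hi j (Finset.mem_of_mem_erase hj)
      (Finset.ne_of_mem_erase hj).symm, Finset.sum_const, ← Nat.cast_smul_eq_nsmul ℂ, smul_smul,
      Finset.card_erase_of_mem hi, Nat.cast_sub (Finset.card_pos.2 ⟨i, hi⟩), Nat.cast_one]
  have h3 : ∑ i ∈ R, ∑ j ∈ A \ R, ρ (swap i j) u = -((A.card - R.card : ℂ) * η) • u := by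
    rw [Finset.sum_comm]
    have : ∀ j ∈ A \ R, ∑ i ∈ R, ρ (swap i j) u = -η • u := by
      intro j hj
      obtain ⟨hjA, hjR⟩ := Finset.mem_sdiff.1 hj
      rw [← sum_swap_of_maximal hη hK hRA hmax huK hu hjA hjR]
      exact Finset.sum_congr rfl fun i _ => by rw [swap_comm]
    rw [Finset.sum_congr rfl this, Finset.sum_const, ← Nat.cast_smul_eq_nsmul ℂ, smul_smul,
      Finset.card_sdiff_of_subset hRA, Nat.cast_sub (Finset.card_le_card hRA), mul_neg]
  rw [Finset.sum_congr rfl h2, Finset.sum_add_distrib, h3, Finset.sum_const,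
    ← Nat.cast_smul_eq_nsmul ℂ, smul_smul, ← add_smul] at h1
  have h4 := smul_left_injective ℂ hu0 h1
  linear_combination (-η) * h4 + ((R.card : ℂ) ^ 2 - A.card) * hη

/-- The maximal number of letters, known from the quadratic equation. -/
lemma eq_zero_of_card_lt {η : ℂ} (hη : η * η = 1) {A : Finset α}
    {K : Submodule ℂ M} (hK : SwapStable ρ A K) {l : ℂ} (hl : ∀ v ∈ K, SwapSumsActBy ρ A l v)
    {m : ℕ} (hm : 0 < m) (hml : η * l * m = (m : ℂ) ^ 2 - A.card) {R : Finset α} (hR : R ⊆ A)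
    {u : M} (huK : u ∈ K) (hu : SwapsActBy ρ η R u) (hlt : m < R.card) : u = 0 := by
  by_contra hu0
  have hne : K ≠ ⊥ := K.ne_bot_iff.2 ⟨u, huK, hu0⟩
  obtain ⟨r, hr⟩ := Finset.card_pos.1 (Nat.zero_lt_of_lt hlt)
  obtain ⟨R₀, -, hR₀, -, hq, hmax⟩ := exists_maximal hη ⟨r, hR hr⟩ hK hl hne
  have := root_unique (Finset.card_pos.2 hR₀) hq hml hm
  exact hu0 (hmax R hR u huK hu (by omega))

/-- On a set of the maximal size, the partial sums of transpositions act by `-η`. -/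
lemma sum_swap_of_card_eq {η : ℂ} (hη : η * η = 1) {A : Finset α} {l : ℂ}
    {m : ℕ} (hml : η * l * m = (m : ℂ) ^ 2 - A.card) {R : Finset α} (hR : R ⊆ A)
    (hRm : R.card = m) (hRne : R.Nonempty) {u : M} (huA : SwapSumsActBy ρ A l u)
    (hu : SwapsActBy ρ η R u) {i : α} (hi : i ∈ A) (hiR : i ∉ R) :
    ∑ j ∈ R, ρ (swap i j) u = -η • u :=
  sum_swap_of_maximal hη (swapStable_swapSumsSubmodule A l) hR
    (fun _ hR' _ hw hwR hlt => eq_zero_of_card_lt hη (swapStable_swapSumsSubmodule A l)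
      (fun _ h => h) (hRm ▸ Finset.card_pos.2 hRne) hml hR' hw hwR (hRm ▸ hlt)) huA hu hi hiR

/-- Removing a set of letters of the maximal size shifts the scalar. -/
lemma SwapSumsActBy.sdiff {η : ℂ} {A : Finset α} {l : ℂ} {R : Finset α} (hR : R ⊆ A) {u : M}
    (huA : SwapSumsActBy ρ A l u)
    (hsum : ∀ i ∈ A \ R, ∑ j ∈ R, ρ (swap i j) u = -η • u) :
    SwapSumsActBy ρ (A \ R) (l + η) u := by
  intro i hi
  have h1 := huA i (Finset.mem_sdiff.1 hi).1
  have hsplit : A.erase i = R ∪ (A \ R).erase i := by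
    ext x
    simp only [Finset.mem_erase, Finset.mem_union, Finset.mem_sdiff] at hi ⊢
    constructor
    · tauto
    · rintro (h | ⟨h, h', -⟩)
      · exact ⟨fun e => hi.2 (e ▸ h), hR h⟩
      · exact ⟨h, h'⟩
  rw [hsplit, Finset.sum_union (by
    rw [Finset.disjoint_left]
    intro x hx hx'
    exact (Finset.mem_sdiff.1 (Finset.mem_of_mem_erase hx')).2 hx), hsum i hi] at h1
  rw [add_smul, ← h1]
  module

/-- A filling by columns of the maximal size. -/
lemma exists_filling {η : ℂ} (hη : η * η = 1) {m : ℕ} (A : Finset α) :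
    ∀ {l : ℂ} {K : Submodule ℂ M}, SwapStable ρ A K → (∀ v ∈ K, SwapSumsActBy ρ A l v) → K ≠ ⊥ →
    (A.Nonempty → 0 < m) → η * l * m = (m : ℂ) ^ 2 - A.card →
    ∃ (b : ℕ) (f : α → ℕ), (∀ x ∈ A, f x < b) ∧ (∀ c < b, (A.filter fun x => f x = c).card = m) ∧
      ∃ u ∈ K, u ≠ 0 ∧ ∀ c < b, SwapsActBy ρ η (A.filter fun x => f x = c) u := by
  induction A using Finset.strongInduction with
  | H A ih =>
    intro l K hK hl hne hm hml
    rcases A.eq_empty_or_nonempty with rfl | hA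
    · obtain ⟨v, hvK, hv0⟩ := K.ne_bot_iff.1 hne
      exact ⟨0, fun _ => 0, by simp, by simp, v, hvK, hv0, by simp⟩
    obtain ⟨R, hRA, hRne, ⟨u, huK, hu0, hu⟩, hq, hmax⟩ := exists_maximal hη hA hK hl hne
    have hRm : R.card = m := root_unique (Finset.card_pos.2 hRne) hq hml (hm hA)
    -- Continuing inside this subspace keeps the symmetry already obtained on `R` while the
    -- remaining letters are filled.
    let K' : Submodule ℂ M :=
      { carrier := {v | v ∈ K ∧ SwapsActBy ρ η R v}
        zero_mem' := ⟨K.zero_mem, fun i _ j _ _ => by simp⟩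
        add_mem' := fun {v w} hv hw => ⟨K.add_mem hv.1 hw.1, fun i hi j hj hij => by
          rw [map_add, hv.2 i hi j hj hij, hw.2 i hi j hj hij, smul_add]⟩
        smul_mem' := fun z v hv => ⟨K.smul_mem z hv.1, fun i hi j hj hij => by
          rw [map_smul, hv.2 i hi j hj hij, smul_comm]⟩ }
    have hK' : SwapStable ρ (A \ R) K' := by
      intro p hp q hq v hv
      rw [Finset.mem_sdiff] at hp hq
      refine ⟨hK p hp.1 q hq.1 v hv.1, fun i hi j hj hij => ?_⟩
      have hfix : ∀ x ∈ R, swap p q x = x := fun x hx =>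
        swap_apply_of_ne_of_ne (fun h => hp.2 (h ▸ hx)) (fun h => hq.2 (h ▸ hx))
      have := rho_swap_conj (ρ := ρ) (swap p q) i j v
      rw [hfix i hi, hfix j hj, hv.2 i hi j hj hij, map_smul] at this
      exact this.symm
    have hl' : ∀ v ∈ K', SwapSumsActBy ρ (A \ R) (l + η) v := fun v hv =>
      (hl v hv.1).sdiff hRA fun i hi => sum_swap_of_maximal hη hK hRA hmax hv.1 hv.2
        (Finset.mem_sdiff.1 hi).1 (Finset.mem_sdiff.1 hi).2
    obtain ⟨b, f, hf, hcard, w, hw, hw0, hwf⟩ := ih (A \ R)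
      (Finset.sdiff_ssubset hRA hRne) hK' hl' (K'.ne_bot_iff.2 ⟨u, ⟨huK, hu⟩, hu0⟩)
      -- The same `m` solves the equation for `A \ R`: both sides grow by `m` when `l` becomes `l +
      -- η` and `|A|` drops by `m`.
      (fun _ => hm hA) (by
        rw [Finset.card_sdiff_of_subset hRA, Nat.cast_sub (Finset.card_le_card hRA), hRm]
        linear_combination hml + m * hη)
    have hfib : ∀ c < b, (A.filter fun x => (if x ∈ R then b else f x) = c) =
        (A \ R).filter fun x => f x = c := by
      intro c hc
      ext x
      simp only [Finset.mem_filter, Finset.mem_sdiff]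
      by_cases hx : x ∈ R
      · simp only [hx, if_true, not_true_eq_false, and_false, false_and, iff_false]
        omega
      · simp [hx]
    have hfib' : (A.filter fun x => (if x ∈ R then b else f x) = b) = R := by
      ext x
      simp only [Finset.mem_filter]
      by_cases hx : x ∈ R
      · simp [hx, hRA hx]
      · simp only [hx, if_false, iff_false, not_and]
        intro hxA
        exact (hf x (Finset.mem_sdiff.2 ⟨hxA, hx⟩)).ne
    refine ⟨b + 1, fun x => if x ∈ R then b else f x, ?_, ?_, w, hw.1, hw0, ?_⟩
    · intro x hx
      by_cases hxR : x ∈ R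
      · simp [hxR]
      · simp only [hxR, if_false]
        exact (hf x (Finset.mem_sdiff.2 ⟨hx, hxR⟩)).trans (Nat.lt_succ_self b)
    · intro c hc
      rcases Nat.lt_succ_iff_lt_or_eq.1 hc with hc | rfl
      · rw [hfib c hc, hcard c hc]
      · rw [hfib', hRm]
    · intro c hc
      rcases Nat.lt_succ_iff_lt_or_eq.1 hc with hc | rfl
      · rw [hfib c hc]
        exact hwf c hc
      · rw [hfib']
        exact hw.2

end TranspositionSums

/-! ### Young symmetrizers of rectangular diagrams act non-trivially -/

section Symmetrizer

variable {α : Type} [DecidableEq α] {M : Type*} [AddCommGroup M] [Module ℂ M]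
  {ρ : Representation ℂ (Perm α) M}

lemma rho_swap_comm {i j p q : α} (h1 : p ≠ i) (h2 : p ≠ j) (h3 : q ≠ i) (h4 : q ≠ j) (v : M) :
    ρ (swap i j) (ρ (swap p q) v) = ρ (swap p q) (ρ (swap i j) v) := by
  rw [rho_swap_conj, swap_apply_of_ne_of_ne h1 h2, swap_apply_of_ne_of_ne h3 h4]

/-- Symmetrizing, over letters in distinct columns, a vector that is antisymmetric in the columns
does not give zero. -/
lemma exists_symmetrized (col : α → ℕ) {A : Finset α} {l : ℂ} {m : ℕ} (hm : 0 < m)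
    (hml : -1 * l * m = (m : ℂ) ^ 2 - A.card) (Q : M →ₗ[ℂ] M) {u : M} (hu0 : u ≠ 0)
    (huA : SwapSumsActBy ρ A l u)
    (hcol : ∀ i ∈ A, ∀ j ∈ A, i ≠ j → col i = col j → ρ (swap i j) u = (-1 : ℂ) • u)
    (R : Finset α) :
    R ⊆ A → Set.InjOn col R → (∀ x ∈ R, (A.filter fun y => col y = col x).card = m) →
    (∀ i ∈ R, ∀ j ∈ R, ∀ v, Q (ρ (swap i j) v) = Q v) →
    ∃ v, v ≠ 0 ∧ SwapSumsActBy ρ A l v ∧ SwapsActBy ρ 1 R v ∧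
      (∀ i ∈ A \ R, ∀ j ∈ A \ R, i ≠ j → col i = col j → ρ (swap i j) v = (-1 : ℂ) • v) ∧
      (∀ i ∉ A, ∀ j ∉ A, ρ (swap i j) u = u → ρ (swap i j) v = v) ∧ ∃ z : ℂ, Q v = z • Q u := by
  induction R using Finset.induction_on with
  | empty =>
    intro _ _ _ _
    exact ⟨u, hu0, huA, fun i hi => absurd hi (Finset.notMem_empty i), by simpa using hcol,
      fun _ _ _ _ h => h, 1, (one_smul _ _).symm⟩
  | insert x R hxR ih =>
    intro hRA hinj hcard hQ
    have hxA : x ∈ A := hRA (Finset.mem_insert_self x R)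
    have hRA' : R ⊆ A := (Finset.subset_insert x R).trans hRA
    obtain ⟨v, hv0, hvA, hvR, hvcol, hvout, z, hz⟩ := ih hRA'
      (hinj.mono (by simp)) (fun y hy => hcard y (Finset.mem_insert_of_mem hy))
      fun i hi j hj => hQ i (Finset.mem_insert_of_mem hi) j (Finset.mem_insert_of_mem hj)
    have hcommute : ∀ i j, i ∉ insert x R → j ∉ insert x R → ∀ c : ℂ, ρ (swap i j) v = c • v →
        ρ (swap i j) (v + (1 : ℂ) • ∑ y ∈ R, ρ (swap x y) v) =
          c • (v + (1 : ℂ) • ∑ y ∈ R, ρ (swap x y) v) := by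
      intro i j hi hj c hc
      rw [Finset.mem_insert, not_or] at hi hj
      rw [map_add, map_smul, map_sum, hc, smul_add, smul_comm c]
      congr 2
      rw [Finset.smul_sum]
      refine Finset.sum_congr rfl fun y hy => (?_ : ρ (swap i j) (ρ (swap x y) v) = c • ρ (swap x y) v)
      rw [rho_swap_comm (Ne.symm hi.1) (Ne.symm hj.1) (fun h => hi.2 (h ▸ hy))
        (fun h => hj.2 (h ▸ hy)), hc, map_smul]
    refine ⟨v + (1 : ℂ) • ∑ y ∈ R, ρ (swap x y) v, ?_, ?_, ?_, ?_, ?_, ?_⟩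
    · intro h0
      -- If the symmetrized vector were zero, summing `s_yj v` over `y ∈ R` and `j` in the column
      -- `C` of `x` in the two orders would give `|R| v = -m v`, hence `|R| + m = 0`.
      set C := A.filter fun y => col y = col x with hC
      have hxC : x ∈ C := Finset.mem_filter.2 ⟨hxA, rfl⟩
      have hCR : ∀ y ∈ R, y ∉ C := by
        intro y hy hyC
        have := hinj (by simp [hy]) (by simp) (Finset.mem_filter.1 hyC).2
        exact hxR (this ▸ hy)
      have hCA : C ⊆ A := Finset.filter_subset _ _
      have hCv : SwapsActBy ρ (-1) C v := fun i hi j hj hij =>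
        hvcol i (Finset.mem_sdiff.2 ⟨hCA hi, fun h => hCR i h hi⟩) j
          (Finset.mem_sdiff.2 ⟨hCA hj, fun h => hCR j h hj⟩) hij
          ((Finset.mem_filter.1 hi).2.trans (Finset.mem_filter.1 hj).2.symm)
      have hCm : C.card = m := hcard x (Finset.mem_insert_self x R)
      -- `C` is an antisymmetric set of the maximal size `m`.
      have hrow : ∀ y ∈ R, ∑ j ∈ C, ρ (swap y j) v = v := by
        intro y hy
        rw [sum_swap_of_card_eq (by norm_num) hml hCA hCm ⟨x, hxC⟩ hvA hCv (hRA' hy) (hCR y hy),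
          neg_neg, one_smul]
      have hx : ∑ y ∈ R, ρ (swap y x) v = -v := by
        rw [one_smul] at h0
        rw [← eq_neg_of_add_eq_zero_right h0]
        exact Finset.sum_congr rfl fun y _ => by rw [swap_comm]
      -- The identity at `x` is carried to the other letters `j` of the column by `s_xj`.
      have hcolumn : ∀ j ∈ C, ∑ y ∈ R, ρ (swap y j) v = -v := by
        intro j hj
        by_cases hjx : j = x
        · rw [hjx, hx]
        have h1 := congrArg (ρ (swap x j)) hx
        rw [map_sum, map_neg, hCv x hxC j hj (Ne.symm hjx)] at h1
        have h2 : ∀ y ∈ R, ρ (swap x j) (ρ (swap y x) v) = -ρ (swap y j) v := by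
          intro y hy
          rw [rho_swap_conj, swap_apply_left,
            swap_apply_of_ne_of_ne (a := x) (b := j) (x := y) (fun h => hxR (h ▸ hy))
              (fun h => hCR y hy (h ▸ hj)),
            hCv x hxC j hj (Ne.symm hjx), map_smul, neg_one_smul]
        rw [Finset.sum_congr rfl h2, Finset.sum_neg_distrib, neg_one_smul, neg_inj] at h1
        exact h1
      have h3 : ∑ y ∈ R, ∑ j ∈ C, ρ (swap y j) v = (R.card : ℂ) • v := by
        rw [Finset.sum_congr rfl hrow, Finset.sum_const, Nat.cast_smul_eq_nsmul]
      rw [Finset.sum_comm, Finset.sum_congr rfl hcolumn, Finset.sum_const, hCm,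
        ← Nat.cast_smul_eq_nsmul ℂ] at h3
      have h4 : ((R.card : ℂ) + m) • v = 0 := by
        rw [add_smul, ← h3]
        module
      have h5 := (smul_eq_zero.1 h4).resolve_right hv0
      have h6 : R.card + m = 0 := by exact_mod_cast h5
      omega
    · exact (swapSumsSubmodule ρ A l).add_mem hvA (Submodule.smul_mem _ _
        (Submodule.sum_mem _ fun y hy => hvA.rho_swap hxA (hRA' hy)))
    · exact hvR.insert_add (one_mul 1) hxR
    · intro i hi j hj hij hcij
      rw [Finset.mem_sdiff] at hi hj
      have hsub : ∀ {i}, i ∉ insert x R → i ∉ R := fun h h' => h (Finset.mem_insert_of_mem h')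
      exact hcommute i j hi.2 hj.2 _ (hvcol i (Finset.mem_sdiff.2 ⟨hi.1, hsub hi.2⟩) j
        (Finset.mem_sdiff.2 ⟨hj.1, hsub hj.2⟩) hij hcij)
    · intro i hi j hj hij
      have := hcommute i j (fun h => hi (hRA h)) (fun h => hj (hRA h)) 1
        (by rw [one_smul]; exact hvout i hi j hj hij)
      rwa [one_smul ℂ (v + (1 : ℂ) • ∑ y ∈ R, ρ (swap x y) v)] at this
    · refine ⟨(1 + R.card) * z, ?_⟩
      rw [map_add, map_smul, map_sum, Finset.sum_congr rfl fun y hy =>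
        hQ x (Finset.mem_insert_self x R) y (Finset.mem_insert_of_mem hy) v, Finset.sum_const,
        ← Nat.cast_smul_eq_nsmul ℂ, hz, one_smul, smul_smul, ← add_smul]
      congr 1
      ring

variable [Fintype α]

/-- A vector on which the transpositions preserving `f` act by a character is an eigenvector of all
permutations preserving `f`. -/
lemma rho_apply_of_swaps (χ : Perm α →* ℂ) (f : α → ℕ) {u : M}
    (hu : ∀ i j, i ≠ j → f i = f j → ρ (swap i j) u = χ (swap i j) • u) (σ : Perm α)
    (hσ : ∀ x, f (σ x) = f x) : ρ σ u = χ σ • u := by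
  induction hN : σ.support.card using Nat.strong_induction_on generalizing σ with
  | _ N ih =>
    by_cases h1 : σ = 1
    · rw [h1, map_one, map_one, one_smul, Module.End.one_apply]
    obtain ⟨x, hx⟩ : ∃ x, σ x ≠ x := by
      by_contra h
      push Not at h
      exact h1 (Equiv.ext h)
    -- Multiplying by `(x σx)` fixes one more letter and stays within the fibres of `f`, so the
    -- induction is on the size of the support.
    have hτ : ∀ y, f ((swap x (σ x) * σ) y) = f y := by
      intro y
      rw [Perm.mul_apply, swap_apply_def]
      split_ifs with h h'
      · rw [hσ, ← hσ y, h]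
      · rw [← hσ y, h', hσ]
      · exact hσ y
    have h2 := ih _ (hN ▸ Perm.card_support_swap_mul hx) _ hτ rfl
    have h3 : σ = swap x (σ x) * (swap x (σ x) * σ) := by rw [← mul_assoc, swap_mul_self, one_mul]
    generalize swap x (σ x) * σ = τ at h2 h3
    rw [h3, rho_mul_apply, h2, map_smul, hu x (σ x) (Ne.symm hx) (hσ x).symm, smul_smul, map_mul,
      mul_comm]

lemma perm_apply_inv (g : Perm α) (x : α) : g (g⁻¹ x) = x := by
  rw [← Perm.mul_apply, mul_inv_cancel, Perm.one_apply]

/-- Fibres of equal size are matched one by one. This relabels a filling by columns so that it fits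
a given tableau. -/
lemma exists_perm_comp_eq (f f' : α → ℕ)
    (h : ∀ c, (Finset.univ.filter fun x => f x = c).card =
      (Finset.univ.filter fun x => f' x = c).card) : ∃ g : Perm α, ∀ x, f' (g x) = f x := by
  have e : ∀ c, Nonempty ({x // f x = c} ≃ {x // f' x = c}) := fun c => by
    rw [← Fintype.card_eq, Fintype.card_subtype, Fintype.card_subtype, h c]
  refine ⟨(sigmaFiberEquiv f).symm.trans
    ((sigmaCongrRight fun c => (e c).some).trans (sigmaFiberEquiv f')), fun x => ?_⟩
  exact ((e (f x)).some ⟨x, rfl⟩).2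

/-! ### Rectangular tableaux and row symmetrization -/

section Rectangle

variable {a b : ℕ} (T : α ≃ {x // x ∈ (rectDiagram a b).cells})

lemma mem_rectDiagram {x : ℕ × ℕ} : x ∈ (rectDiagram a b).cells ↔ x.1 < a ∧ x.2 < b := by
  simp [rectDiagram]

lemma row_lt (x : α) : (T x).1.1 < a := (mem_rectDiagram.1 (T x).2).1

lemma col_lt (x : α) : (T x).1.2 < b := (mem_rectDiagram.1 (T x).2).2

include T in
lemma card_letters : Fintype.card α = a * b := by
  rw [Fintype.card_congr T, Fintype.card_coe]
  simp [rectDiagram]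

lemma card_filter_cells (p : ℕ × ℕ → Prop) [DecidablePred p] :
    (Finset.univ.filter fun x : α => p (T x).1).card =
      ((Finset.range a ×ˢ Finset.range b).filter p).card := by
  refine Finset.card_bij (fun x _ => (T x).1) ?_ ?_ ?_
  · intro x hx
    exact Finset.mem_filter.2 ⟨(T x).2, (Finset.mem_filter.1 hx).2⟩
  · intro x _ y _ h
    exact T.injective (Subtype.ext h)
  · intro x hx
    obtain ⟨hx1, hx2⟩ := Finset.mem_filter.1 hx
    exact ⟨T.symm ⟨x, hx1⟩, by simpa using hx2, by simp⟩

/-- Once the rows above `r` are symmetrized, the remaining columns have height `a - r`, the maximal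
size of an antisymmetric set for the shifted scalar. -/
lemma card_col_ge {c r : ℕ} (hc : c < b) :
    (Finset.univ.filter fun x : α => r ≤ (T x).1.1 ∧ (T x).1.2 = c).card = a - r := by
  rw [card_filter_cells T fun x => r ≤ x.1 ∧ x.2 = c]
  have : ((Finset.range a ×ˢ Finset.range b).filter fun x => r ≤ x.1 ∧ x.2 = c) =
      Finset.Ico r a ×ˢ {c} := by
    ext ⟨x, y⟩
    simp
    constructor
    · rintro ⟨⟨h, -⟩, h', rfl⟩
      exact ⟨⟨h', h⟩, rfl⟩
    · rintro ⟨⟨h', h⟩, rfl⟩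
      exact ⟨⟨h, hc⟩, h', rfl⟩
  rw [this]
  simp

lemma card_row {r : ℕ} (hr : r < a) :
    (Finset.univ.filter fun x : α => (T x).1.1 = r).card = b := by
  rw [card_filter_cells T fun x => x.1 = r]
  have : ((Finset.range a ×ˢ Finset.range b).filter fun x => x.1 = r) =
      {r} ×ˢ Finset.range b := by
    ext ⟨x, y⟩
    simp
    constructor
    · rintro ⟨⟨-, h⟩, rfl⟩
      exact ⟨h, rfl⟩
    · rintro ⟨h, rfl⟩
      exact ⟨⟨hr, h⟩, rfl⟩
  rw [this]
  simp

lemma card_row_ge (r : ℕ) :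
    (Finset.univ.filter fun x : α => r ≤ (T x).1.1).card = (a - r) * b := by
  rw [card_filter_cells T fun x => r ≤ x.1]
  have : ((Finset.range a ×ˢ Finset.range b).filter fun x => r ≤ x.1) =
      Finset.Ico r a ×ˢ Finset.range b := by
    ext ⟨x, y⟩
    simp
    tauto
  rw [this]
  simp

/-- Symmetrizing the rows of a vector that is antisymmetric in the columns. -/
lemma exists_row_symmetrized (Q : M →ₗ[ℂ] M)
    (hQ : ∀ i j, (T i).1.1 = (T j).1.1 → ∀ v, Q (ρ (swap i j) v) = Q v) {u : M} (hu0 : u ≠ 0)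
    (huA : SwapSumsActBy ρ Finset.univ ((b : ℂ) - a) u)
    (hcol : ∀ i j, i ≠ j → (T i).1.2 = (T j).1.2 → ρ (swap i j) u = (-1 : ℂ) • u) (r : ℕ) :
    r ≤ a → ∃ v, v ≠ 0 ∧
      SwapSumsActBy ρ (Finset.univ.filter fun x => r ≤ (T x).1.1) ((b : ℂ) - a + r) v ∧
      (∀ i j, r ≤ (T i).1.1 → r ≤ (T j).1.1 → i ≠ j → (T i).1.2 = (T j).1.2 →
        ρ (swap i j) v = (-1 : ℂ) • v) ∧
      (∀ i j, i ≠ j → (T i).1.1 = (T j).1.1 → (T i).1.1 < r → ρ (swap i j) v = v) ∧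
      ∃ z : ℂ, Q v = z • Q u := by
  induction r with
  | zero =>
    intro _
    exact ⟨u, hu0, by simpa using huA, fun i j _ _ => hcol i j, fun _ _ _ _ h => absurd h (by simp),
      1, (one_smul _ _).symm⟩
  | succ r ih =>
    intro hr
    obtain ⟨v, hv0, hvA, hvcol, hvrow, z, hz⟩ := ih (by omega)
    set A := Finset.univ.filter fun x : α => r ≤ (T x).1.1 with hA
    set R := Finset.univ.filter fun x : α => (T x).1.1 = r with hR
    have hRA : R ⊆ A := fun x hx => by
      simp only [hA, hR, Finset.mem_filter, Finset.mem_univ, true_and] at hx ⊢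
      omega
    have hAR : A \ R = Finset.univ.filter fun x : α => r + 1 ≤ (T x).1.1 := by
      ext x
      simp only [hA, hR, Finset.mem_filter, Finset.mem_univ, true_and, Finset.mem_sdiff]
      omega
    have hAcard : (A.card : ℂ) = ((a : ℂ) - r) * b := by
      rw [hA, card_row_ge, Nat.cast_mul, Nat.cast_sub (by omega)]
    obtain ⟨w, hw0, hwA, hwR, hwcol, hwout, z', hz'⟩ := exists_symmetrized (ρ := ρ)
      (fun x => (T x).1.2) (A := A) (l := (b : ℂ) - a + r) (m := a - r) (by omega)
      (by rw [hAcard, Nat.cast_sub (by omega)]; ring) Q hv0 hvA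
      (fun i hi j hj => hvcol i j (Finset.mem_filter.1 hi).2 (Finset.mem_filter.1 hj).2) R hRA
      (by
        intro x hx y hy hxy
        have hx := (Finset.mem_filter.1 hx).2
        have hy := (Finset.mem_filter.1 hy).2
        exact T.injective (Subtype.ext (Prod.ext (hx.trans hy.symm) hxy)))
      (by
        intro x _
        rw [hA, Finset.filter_filter]
        exact card_col_ge T (col_lt T x))
      (by
        intro i hi j hj
        exact hQ i j ((Finset.mem_filter.1 hi).2.trans (Finset.mem_filter.1 hj).2.symm))
    refine ⟨w, hw0, ?_, ?_, ?_, z' * z, by rw [hz', hz, smul_smul]⟩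
    · rw [← hAR]
      have := hwA.sdiff (η := 1) hRA fun i hi => ?_
      · rw [Nat.cast_succ, ← add_assoc]
        exact this
      have hb : 0 < b := (Nat.zero_le _).trans_lt (col_lt T i)
      have hRb : R.card = b := card_row T (by omega)
      -- For `η = 1` the positive root is the row length: `(b - a + r) b = b² - (a - r) b`.
      exact sum_swap_of_card_eq (one_mul 1) (by rw [hAcard]; ring) hRA hRb
        (Finset.card_pos.1 (by omega)) hwA hwR (Finset.mem_sdiff.1 hi).1 (Finset.mem_sdiff.1 hi).2
    · intro i j hi hj
      exact hwcol i (hAR ▸ Finset.mem_filter.2 ⟨Finset.mem_univ _, hi⟩) j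
        (hAR ▸ Finset.mem_filter.2 ⟨Finset.mem_univ _, hj⟩)
    · intro i j hij hrow hi
      rcases Nat.lt_succ_iff_lt_or_eq.1 hi with hi | hi
      · refine hwout i ?_ j ?_ (hvrow i j hij hrow hi)
        · simp only [hA, Finset.mem_filter, Finset.mem_univ, true_and]
          omega
        · simp only [hA, Finset.mem_filter, Finset.mem_univ, true_and]
          omega
      · have := hwR i (Finset.mem_filter.2 ⟨Finset.mem_univ _, hi⟩) j
          (Finset.mem_filter.2 ⟨Finset.mem_univ _, hrow ▸ hi⟩) hij
        rwa [one_smul] at this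

lemma asAlgebraHom_youngSymmetrizer {μ : YoungDiagram} (T : α ≃ {x // x ∈ μ.cells}) (v : M) :
    ρ.asAlgebraHom (youngSymmetrizer T) v =
      (∑ σ ∈ rowGroup T, ρ σ) (∑ σ ∈ colGroup T, ((Perm.sign σ : ℤ) : ℂ) • ρ σ v) := by
  simp only [youngSymmetrizer, map_mul, Module.End.mul_apply, map_sum, map_smul,
    Representation.asAlgebraHom_of, LinearMap.sum_apply, LinearMap.smul_apply]

/-- The sign character with complex values. -/
def signChar (α : Type) [DecidableEq α] [Fintype α] : Perm α →* ℂ :=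
  ((Int.castRingHom ℂ : ℤ →* ℂ).comp (Units.coeHom ℤ)).comp Perm.sign

lemma signChar_apply (σ : Perm α) : signChar α σ = ((Perm.sign σ : ℤ) : ℂ) := rfl

lemma signChar_swap {i j : α} (h : i ≠ j) : signChar α (swap i j) = -1 := by
  rw [signChar_apply, Perm.sign_swap h]
  simp

lemma signChar_mul_self (σ : Perm α) : signChar α σ * signChar α σ = 1 := by
  rw [signChar_apply]
  rcases Int.units_eq_one_or (Perm.sign σ) with h | h <;> simp [h]

/-- The Young symmetrizer of a rectangle does not kill a vector antisymmetric in the columns. -/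
lemma youngSymmetrizer_apply_ne_zero {u : M} (hu0 : u ≠ 0)
    (huA : SwapSumsActBy ρ Finset.univ ((b : ℂ) - a) u)
    (hcol : ∀ i j, i ≠ j → (T i).1.2 = (T j).1.2 → ρ (swap i j) u = (-1 : ℂ) • u) :
    ρ.asAlgebraHom (youngSymmetrizer T) u ≠ 0 := by
  set Q : M →ₗ[ℂ] M := ∑ σ ∈ rowGroup T, ρ σ with hQdef
  have hQ : ∀ i j, (T i).1.1 = (T j).1.1 → ∀ v, Q (ρ (swap i j) v) = Q v := by
    intro i j hij v
    simp only [hQdef, LinearMap.sum_apply, ← rho_mul_apply]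
    refine Finset.sum_equiv (Equiv.mulRight (swap i j)) (fun σ => ?_) fun _ _ => rfl
    have hs : ∀ x, (T (swap i j x)).1.1 = (T x).1.1 := by
      intro x
      rw [swap_apply_def]
      split_ifs with h h'
      · rw [h, hij]
      · rw [h', hij]
      · rfl
    simp only [rowGroup, Finset.mem_filter, Finset.mem_univ, true_and, Equiv.coe_mulRight,
      Perm.mul_apply]
    constructor
    · intro h x
      rw [h, hs]
    · intro h x
      have := h (swap i j x)
      rwa [swap_apply_self, hs] at this
  -- With all `a` rows treated, `v` is fixed by the row group, so `Q v` is a nonzero multiple of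
  -- `v`; as it is also a multiple of `Q u`, the latter cannot vanish.
  obtain ⟨v, hv0, -, -, hvrow, z, hz⟩ := exists_row_symmetrized T Q hQ hu0 huA hcol a le_rfl
  have hQv : Q v = ((rowGroup T).card : ℂ) • v := by
    rw [hQdef, LinearMap.sum_apply, Finset.sum_congr rfl fun σ hσ => ?_, Finset.sum_const,
      Nat.cast_smul_eq_nsmul]
    have := rho_apply_of_swaps (1 : Perm α →* ℂ) (fun x => (T x).1.1) (u := v)
      (fun i j hij h => by rw [hvrow i j hij h (row_lt T i), MonoidHom.one_apply, one_smul]) σ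
      (Finset.mem_filter.1 hσ).2
    rwa [MonoidHom.one_apply, one_smul] at this
  have hrow0 : ((rowGroup T).card : ℂ) ≠ 0 := by
    have : (1 : Perm α) ∈ rowGroup T := by simp [rowGroup]
    exact_mod_cast (Finset.card_pos.2 ⟨_, this⟩).ne'
  have hcol0 : ((colGroup T).card : ℂ) ≠ 0 := by
    have : (1 : Perm α) ∈ colGroup T := by simp [colGroup]
    exact_mod_cast (Finset.card_pos.2 ⟨_, this⟩).ne'
  have hC : ∑ σ ∈ colGroup T, ((Perm.sign σ : ℤ) : ℂ) • ρ σ u = ((colGroup T).card : ℂ) • u := by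
    rw [Finset.sum_congr rfl fun σ hσ => ?_, Finset.sum_const, Nat.cast_smul_eq_nsmul]
    rw [rho_apply_of_swaps (signChar α) (fun x => (T x).1.2)
      (fun i j hij h => by rw [hcol i j hij h, signChar_swap hij]) σ (Finset.mem_filter.1 hσ).2,
      ← signChar_apply, smul_smul, signChar_mul_self, one_smul]
  rw [asAlgebraHom_youngSymmetrizer, hC, map_smul]
  refine smul_ne_zero hcol0 fun h0 => ?_
  rw [h0, smul_zero, hQv] at hz
  exact smul_ne_zero hrow0 hv0 hz

/-- If the sums of transpositions act by the scalar `b - a`, the Young symmetrizers of the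
rectangle of height `a` and width `b` act non-trivially on every stable subspace. -/
lemma exists_youngSymmetrizer_apply_ne_zero
    (hl : ∀ v, SwapSumsActBy ρ Finset.univ ((b : ℂ) - a) v) {K : Submodule ℂ M}
    (hK : ∀ g, ∀ v ∈ K, ρ g v ∈ K) (hne : K ≠ ⊥) :
    ∃ v ∈ K, ρ.asAlgebraHom (youngSymmetrizer T) v ≠ 0 := by
  have hab : (Fintype.card α : ℂ) = a * b := by exact_mod_cast card_letters T
  obtain ⟨b', f, hf, hfcard, u, huK, hu0, hu⟩ := exists_filling (ρ := ρ) (η := -1) (by norm_num)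
    (m := a) Finset.univ (l := (b : ℂ) - a) (K := K) (fun p _ q _ => hK (swap p q))
    (fun v _ => hl v) hne (fun ⟨x, _⟩ => (Nat.zero_le _).trans_lt (row_lt T x))
    (by rw [Finset.card_univ, hab]; ring)
  -- The filling has columns of height `a`, hence `b` of them, and a permutation of the letters
  -- turns them into the columns of `T`.
  have hg : ∃ g : Perm α, ∀ x, (T (g x)).1.2 = f x := by
    rcases isEmpty_or_nonempty α with hα | ⟨⟨x₀⟩⟩
    · exact ⟨1, fun x => isEmptyElim x⟩
    have ha : 0 < a := (Nat.zero_le _).trans_lt (row_lt T x₀)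
    have hbb' : b' = b := by
      have h1 := Finset.card_eq_sum_card_fiberwise (f := f) (s := Finset.univ)
        (t := Finset.range b') fun x hx => Finset.mem_coe.2 (Finset.mem_range.2 (hf x hx))
      rw [Finset.sum_congr rfl fun c hc => hfcard c (Finset.mem_range.1 hc), Finset.sum_const,
        Finset.card_range, Finset.card_univ, card_letters T, smul_eq_mul, mul_comm] at h1
      exact (Nat.eq_of_mul_eq_mul_right ha h1).symm
    refine exists_perm_comp_eq f (fun x => (T x).1.2) fun c => ?_
    rcases lt_or_ge c b with hc | hc
    · rw [hfcard c (hbb' ▸ hc)]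
      simpa using (card_col_ge T (r := 0) hc).symm
    · rw [Finset.filter_false_of_mem, Finset.filter_false_of_mem]
      · intro x _
        exact ((col_lt T x).trans_le hc).ne
      · intro x hx
        exact ((hf x hx).trans_le (hbb' ▸ hc)).ne
  obtain ⟨g, hg⟩ := hg
  refine ⟨ρ g u, hK g u huK, youngSymmetrizer_apply_ne_zero T ?_ (hl _) ?_⟩
  · intro h0
    apply hu0
    have := congrArg (ρ g⁻¹) h0
    rwa [← rho_mul_apply, inv_mul_cancel, map_one, Module.End.one_apply, map_zero] at this
  · intro i j hij hcij
    have hi := hg (g⁻¹ i)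
    have hj := hg (g⁻¹ j)
    rw [perm_apply_inv] at hi hj
    have h1 := hu (f (g⁻¹ i)) (hf _ (Finset.mem_univ _)) (g⁻¹ i)
      (Finset.mem_filter.2 ⟨Finset.mem_univ _, rfl⟩) (g⁻¹ j)
      (Finset.mem_filter.2 ⟨Finset.mem_univ _, by rw [← hi, ← hj, hcij]⟩)
      (fun h => hij (g⁻¹.injective h))
    have h2 := rho_swap_conj (ρ := ρ) g (g⁻¹ i) (g⁻¹ j) u
    rw [h1, perm_apply_inv, perm_apply_inv, map_smul] at h2
    exact h2.symm

end Rectangle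

/-- If the sums of transpositions act by a scalar, this scalar is the difference of the sides of a
rectangle. -/
lemma exists_rectangle [Nontrivial M] {l : ℂ} (hl : ∀ v, SwapSumsActBy ρ Finset.univ l v) :
    ∃ a b : ℕ, a * b = Fintype.card α ∧ (Nonempty α → l = (b : ℂ) - a) := by
  rcases isEmpty_or_nonempty α with hα | hα
  -- Without letters the scalar is unconstrained, and the empty rectangle is used.
  · exact ⟨0, 0, by simp, fun h => absurd h (not_nonempty_iff.2 hα)⟩
  obtain ⟨R, -, hR, -, hq, -⟩ := exists_maximal (ρ := ρ) (η := -1) (by norm_num)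
    Finset.univ_nonempty (K := ⊤) (fun _ _ _ _ _ _ => trivial) (fun v _ => hl v) top_ne_bot
  obtain ⟨b, f, hf, hfcard, -⟩ := exists_filling (ρ := ρ) (η := -1) (by norm_num)
    (m := R.card) Finset.univ (K := ⊤) (fun _ _ _ _ _ _ => trivial) (fun v _ => hl v) top_ne_bot
    (fun _ => Finset.card_pos.2 hR) hq
  have h1 := Finset.card_eq_sum_card_fiberwise (f := f) (s := Finset.univ)
    (t := Finset.range b) fun x hx => Finset.mem_coe.2 (Finset.mem_range.2 (hf x hx))
  rw [Finset.sum_congr rfl fun c hc => hfcard c (Finset.mem_range.1 hc), Finset.sum_const,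
    Finset.card_range, Finset.card_univ, smul_eq_mul, mul_comm] at h1
  refine ⟨R.card, b, h1.symm, fun _ => ?_⟩
  have hR0 : (R.card : ℂ) ≠ 0 := by exact_mod_cast (Finset.card_pos.2 hR).ne'
  rw [Finset.card_univ, h1, Nat.cast_mul] at hq
  refine mul_right_cancel₀ hR0 ?_
  linear_combination -hq

end Symmetrizer

/-! ### Specht modules of rectangles -/

section RectangleSpecht

variable {α : Type} [Fintype α] [DecidableEq α]

lemma eq_zero_of_eq_neg {M : Type*} [AddCommGroup M] [Module ℂ M] {x : M} (h : x = -x) : x = 0 := by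
  have h2 : (2 : ℂ) • x = 0 := by
    rw [two_smul]
    exact add_eq_zero_iff_eq_neg.2 h
  exact (smul_eq_zero.1 h2).resolve_left two_ne_zero

/-! ### One-sided invariance of the row and column sums -/

section Diagram

variable {μ : YoungDiagram} (T : α ≃ {x // x ∈ μ.cells})

/-- The row symmetrizer. -/
def rowSum : MonoidAlgebra ℂ (Perm α) := ∑ σ ∈ rowGroup T, MonoidAlgebra.of ℂ (Perm α) σ

/-- The column antisymmetrizer. -/
def colSum : MonoidAlgebra ℂ (Perm α) :=
  ∑ σ ∈ colGroup T, ((Perm.sign σ : ℤ) : ℂ) • MonoidAlgebra.of ℂ (Perm α) σ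

lemma youngSymmetrizer_eq : youngSymmetrizer T = rowSum T * colSum T := rfl

lemma rowSum_mul_of {p : Perm α} (hp : p ∈ rowGroup T) :
    rowSum T * MonoidAlgebra.of ℂ _ p = rowSum T := by
  simp only [rowSum, Finset.sum_mul, ← map_mul]
  refine Finset.sum_equiv (Equiv.mulRight p) (fun σ => ?_) fun _ _ => rfl
  simp only [rowGroup, Finset.mem_filter, Finset.mem_univ, true_and, Equiv.coe_mulRight,
    Perm.mul_apply] at hp ⊢
  constructor
  · intro h x
    rw [h, hp]
  · intro h x
    have h1 := h (p⁻¹ x)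
    have h2 := hp (p⁻¹ x)
    simp only [perm_apply_inv] at h1 h2
    rw [h1, ← h2]

lemma of_mul_rowSum {p : Perm α} (hp : p ∈ rowGroup T) :
    MonoidAlgebra.of ℂ _ p * rowSum T = rowSum T := by
  simp only [rowSum, Finset.mul_sum, ← map_mul]
  refine Finset.sum_equiv (Equiv.mulLeft p) (fun σ => ?_) fun _ _ => rfl
  simp only [rowGroup, Finset.mem_filter, Finset.mem_univ, true_and, Equiv.coe_mulLeft,
    Perm.mul_apply] at hp ⊢
  simp only [hp]

lemma of_mul_colSum {q : Perm α} (hq : q ∈ colGroup T) :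
    MonoidAlgebra.of ℂ _ q * colSum T = signChar α q • colSum T := by
  simp only [colSum, Finset.mul_sum, mul_smul_comm, ← map_mul, Finset.smul_sum, smul_smul,
    ← signChar_apply]
  refine Finset.sum_equiv (Equiv.mulLeft q) (fun σ => ?_) fun σ _ => ?_
  · simp only [colGroup, Finset.mem_filter, Finset.mem_univ, true_and, Equiv.coe_mulLeft,
      Perm.mul_apply] at hq ⊢
    simp only [hq]
  · change _ = signChar α (q * (q * σ)) • MonoidAlgebra.of ℂ _ (q * σ)
    rw [map_mul (signChar α), map_mul (signChar α), ← mul_assoc, signChar_mul_self, one_mul]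

lemma colSum_mul_of {q : Perm α} (hq : q ∈ colGroup T) :
    colSum T * MonoidAlgebra.of ℂ _ q = signChar α q • colSum T := by
  simp only [colSum, Finset.sum_mul, smul_mul_assoc, ← map_mul, Finset.smul_sum, smul_smul,
    ← signChar_apply]
  refine Finset.sum_equiv (Equiv.mulRight q) (fun σ => ?_) fun σ _ => ?_
  · simp only [colGroup, Finset.mem_filter, Finset.mem_univ, true_and, Equiv.coe_mulRight,
      Perm.mul_apply] at hq ⊢
    constructor
    · intro h x
      rw [h, hq]
    · intro h x
      have h1 := h (q⁻¹ x)
      have h2 := hq (q⁻¹ x)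
      simp only [perm_apply_inv] at h1 h2
      rw [h1, ← h2]
  · change _ = signChar α (q * (σ * q)) • MonoidAlgebra.of ℂ _ (σ * q)
    rw [map_mul (signChar α), map_mul (signChar α), mul_comm (signChar α σ), ← mul_assoc,
      signChar_mul_self, one_mul]

lemma swap_mem_rowGroup {x y : α} (h : (T x).1.1 = (T y).1.1) : swap x y ∈ rowGroup T := by
  simp only [rowGroup, Finset.mem_filter, Finset.mem_univ, true_and]
  intro z
  rw [swap_apply_def]
  split_ifs with h1 h2
  · rw [h1, h]
  · rw [h2, h]
  · rfl

lemma swap_mem_colGroup {x y : α} (h : (T x).1.2 = (T y).1.2) : swap x y ∈ colGroup T := by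
  simp only [colGroup, Finset.mem_filter, Finset.mem_univ, true_and]
  intro z
  rw [swap_apply_def]
  split_ifs with h1 h2
  · rw [h1, h]
  · rw [h2, h]
  · rfl

lemma swap_mul_eq (g : Perm α) (x y : α) : swap x y * g = g * swap (g⁻¹ x) (g⁻¹ y) := by
  rw [swap_apply_apply, inv_inv, ← mul_assoc, mul_inv_cancel_left]

lemma coe_spechtRep (g : Perm α) (z : SpechtModule T) :
    (spechtRep T g z : MonoidAlgebra ℂ (Perm α)) = MonoidAlgebra.of ℂ _ g * z := rfl

lemma coe_asAlgebraHom_spechtRep (y : MonoidAlgebra ℂ (Perm α)) (z : SpechtModule T) :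
    ((spechtRep T).asAlgebraHom y z : MonoidAlgebra ℂ (Perm α)) = y * z := by
  induction y using MonoidAlgebra.induction_on with
  | of g => rw [Representation.asAlgebraHom_of, coe_spechtRep]
  | add y y' hy hy' => rw [map_add, LinearMap.add_apply, Submodule.coe_add, hy, hy', add_mul]
  | smul r y hy =>
    rw [map_smul, LinearMap.smul_apply, smul_mul_assoc, ← hy]
    rfl

/-- The Young symmetrizer as an element of the Specht module. -/
def spechtGen : SpechtModule T := ⟨youngSymmetrizer T, Ideal.mem_span_singleton_self _⟩

lemma exists_eq_asAlgebraHom_spechtGen (z : SpechtModule T) :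
    ∃ y, z = (spechtRep T).asAlgebraHom y (spechtGen T) := by
  obtain ⟨y, hy⟩ := Ideal.mem_span_singleton'.1 z.2
  exact ⟨y, Subtype.ext (by rw [coe_asAlgebraHom_spechtRep, ← hy]; rfl)⟩

/-- Elements of the left ideal end with the column antisymmetrizer. This right antisymmetry is what
forces coefficients to vanish in `spechtModule_eq_zero`. -/
lemma spechtModule_mul_swap (z : SpechtModule T) {x y : α} (hxy : x ≠ y)
    (h : (T x).1.2 = (T y).1.2) : z.1 * MonoidAlgebra.of ℂ _ (swap x y) = -z.1 := by
  obtain ⟨w, hw⟩ := Ideal.mem_span_singleton'.1 z.2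
  rw [← hw, youngSymmetrizer_eq, mul_assoc, mul_assoc, colSum_mul_of T (swap_mem_colGroup T h),
    signChar_swap hxy]
  simp

end Diagram

variable {a b : ℕ} (T : α ≃ {x // x ∈ (rectDiagram a b).cells})

/-- A vector of the Specht module of a rectangle that is symmetric in more letters than the width
vanishes. -/
lemma spechtModule_eq_zero {R : Finset α} (hR : b < R.card) {z : SpechtModule T}
    (hz : SwapsActBy (spechtRep T) 1 R z) : z = 0 := by
  apply Subtype.ext
  apply MonoidAlgebra.coeff_injective
  ext g
  -- By pigeonhole two letters of `R` lie in one column of the tableau moved by `g`. Left symmetry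
  -- and right antisymmetry then give the coefficient at `g` opposite values.
  obtain ⟨x, hx, y, hy, hxy, hcol⟩ := Finset.exists_ne_map_eq_of_card_lt_of_maps_to
    (s := R) (t := Finset.range b) (f := fun x => (T (g⁻¹ x)).1.2) (by simpa using hR)
    (fun x _ => Finset.mem_coe.2 (Finset.mem_range.2 (col_lt T _)))
  have h1 := congrArg Subtype.val (hz x hx y hy hxy)
  rw [coe_spechtRep, one_smul] at h1
  have h2 := spechtModule_mul_swap T z (g⁻¹.injective.ne hxy) hcol
  have h3 : z.1.coeff g = z.1.coeff (swap x y * g) := by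
    conv_lhs => rw [← h1]
    rw [MonoidAlgebra.of_apply, MonoidAlgebra.coeff_single_mul_apply, one_mul, swap_inv]
  have h4 : -z.1.coeff g = z.1.coeff (swap x y * g) := by
    rw [← Finsupp.neg_apply, ← MonoidAlgebra.coeff_neg, ← h2, MonoidAlgebra.of_apply,
      MonoidAlgebra.coeff_mul_single_apply, mul_one, swap_inv, swap_mul_eq]
  have h5 : z.1.coeff g = -z.1.coeff g := h3.trans h4.symm
  have h6 : z.1.coeff g = 0 := eq_zero_of_eq_neg h5
  simpa using h6

lemma swapsActBy_spechtGen (r : ℕ) :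
    SwapsActBy (spechtRep T) 1 (Finset.univ.filter fun x => (T x).1.1 = r) (spechtGen T) := by
  intro x hx y hy _
  apply Subtype.ext
  rw [coe_spechtRep, one_smul]
  change _ * youngSymmetrizer T = youngSymmetrizer T
  rw [youngSymmetrizer_eq, ← mul_assoc, of_mul_rowSum T (swap_mem_rowGroup T
    ((Finset.mem_filter.1 hx).2.trans (Finset.mem_filter.1 hy).2.symm))]

/-- In the Specht module of a rectangle the sums of transpositions act by the difference of the
sides. -/
lemma swapSumsActBy_spechtRep (v : SpechtModule T) :
    SwapSumsActBy (spechtRep T) Finset.univ ((b : ℂ) - a) v := by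
  set c := spechtGen T with hc
  -- A row together with one more letter has `b + 1` letters, so symmetrizing the generator over
  -- them gives zero.
  have hrow : ∀ i, ∀ r < a, r ≠ (T i).1.1 →
      ∑ j ∈ Finset.univ.filter (fun x => (T x).1.1 = r), spechtRep T (swap i j) c = -c := by
    intro i r hr hri
    have hi : i ∉ Finset.univ.filter fun x => (T x).1.1 = r := by simpa using Ne.symm hri
    have h0 := spechtModule_eq_zero T (by
      rw [Finset.card_insert_of_notMem hi, card_row T hr]
      exact Nat.lt_succ_self b) ((swapsActBy_spechtGen T r).insert_add (one_mul 1) hi)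
    rw [one_smul] at h0
    exact (neg_eq_of_add_eq_zero_right h0).symm
  have hgen : SwapSumsActBy (spechtRep T) Finset.univ ((b : ℂ) - a) c := by
    intro i _
    -- The row of `i` contributes `b`, each of the other `a - 1` rows contributes `-1`; the term `j
    -- = i`, equal to the identity, is removed afterwards, leaving `b - a`.
    have h1 : ∑ j, spechtRep T (swap i j) c =
        ∑ r ∈ Finset.range a, if r = (T i).1.1 then (b : ℂ) • c else -c := by
      rw [← Finset.sum_fiberwise_of_maps_to (s := Finset.univ) (t := Finset.range a)
        (g := fun j => (T j).1.1) fun j _ => Finset.mem_range.2 (row_lt T j)]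
      refine Finset.sum_congr rfl fun r hr => ?_
      rw [Finset.mem_range] at hr
      split_ifs with h
      · have h2 : ∀ j ∈ Finset.univ.filter (fun x => (T x).1.1 = r),
            spechtRep T (swap i j) c = c := by
          intro j hj
          by_cases hij : i = j
          · rw [hij, swap_self, ← Perm.one_def, map_one, Module.End.one_apply]
          · rw [swapsActBy_spechtGen T r i (by simp [h]) j hj hij, one_smul]
        rw [Finset.sum_congr rfl h2, Finset.sum_const, card_row T hr, Nat.cast_smul_eq_nsmul]
      · exact hrow i r hr h
    rw [Finset.sum_ite, Finset.filter_eq', if_pos (Finset.mem_range.2 (row_lt T i)),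
      Finset.sum_singleton, Finset.sum_const, Finset.filter_ne', Finset.card_erase_of_mem
      (Finset.mem_range.2 (row_lt T i)), Finset.card_range, ← Nat.cast_smul_eq_nsmul ℂ,
      Nat.cast_sub ((Nat.zero_le _).trans_lt (row_lt T i)), ← Finset.add_sum_erase _ _
      (Finset.mem_univ i), swap_self, ← Perm.one_def, map_one, Module.End.one_apply] at h1
    rw [eq_sub_of_add_eq' h1]
    push_cast
    module
  obtain ⟨y, rfl⟩ := exists_eq_asAlgebraHom_spechtGen T v
  refine Representation.asAlgebraHom_mem_of_forall_mem (spechtRep T)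
    (swapSumsSubmodule (spechtRep T) Finset.univ ((b : ℂ) - a)) ?_ c hgen y
  intro g w hw
  induction g using Perm.swap_induction_on generalizing w with
  | one => rwa [map_one, Module.End.one_apply]
  | swap_mul g x y _ ih =>
    rw [rho_mul_apply]
    exact SwapSumsActBy.rho_swap (ih w hw) (Finset.mem_univ x) (Finset.mem_univ y)

/-- Either two letters share a row of `T` and a column of the tableau moved by `g`, and their
transposition makes the product its own negative; or `g` is a row permutation times a column
permutation, and both are absorbed up to sign. -/
lemma rowSum_of_colSum (g : Perm α) :
    rowSum T * MonoidAlgebra.of ℂ _ g * colSum T ∈ Submodule.span ℂ {youngSymmetrizer T} := by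
  by_cases h : ∃ x y, x ≠ y ∧ (T x).1.1 = (T y).1.1 ∧ (T (g⁻¹ x)).1.2 = (T (g⁻¹ y)).1.2
  · obtain ⟨x, y, hxy, hrow, hcol⟩ := h
    have h1 : rowSum T * MonoidAlgebra.of ℂ _ g * colSum T =
        -(rowSum T * MonoidAlgebra.of ℂ _ g * colSum T) := by
      conv_lhs => rw [← rowSum_mul_of T (swap_mem_rowGroup T hrow), mul_assoc (rowSum T), ← map_mul,
        swap_mul_eq, map_mul, ← mul_assoc, mul_assoc, of_mul_colSum T (swap_mem_colGroup T hcol),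
        signChar_swap (g⁻¹.injective.ne hxy), neg_one_smul, mul_neg]
    have h2 : rowSum T * MonoidAlgebra.of ℂ _ g * colSum T = 0 := eq_zero_of_eq_neg h1
    rw [h2]
    exact Submodule.zero_mem _
  · push Not at h
    -- Any row index paired with any column index is a cell because the diagram is a rectangle. The
    -- map `f` sends `x` to the letter of that cell.
    have hmem : ∀ x, ((T x).1.1, (T (g⁻¹ x)).1.2) ∈ (rectDiagram a b).cells := fun x =>
      mem_rectDiagram.2 ⟨row_lt T x, col_lt T _⟩
    let f : α → α := fun x => T.symm ⟨_, hmem x⟩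
    have hf : ∀ x, (T (f x)).1 = ((T x).1.1, (T (g⁻¹ x)).1.2) := fun x => by simp [f]
    have hinj : Function.Injective f := by
      intro x y hxy
      have h1 := (hf x).symm.trans ((congrArg (fun t => (T t).1) hxy).trans (hf y))
      rw [Prod.mk.injEq] at h1
      by_contra hne
      exact h x y hne h1.1 h1.2
    let p : Perm α := Equiv.ofBijective f (Finite.injective_iff_bijective.1 hinj)
    have hp : p ∈ rowGroup T := by
      simp only [rowGroup, Finset.mem_filter, Finset.mem_univ, true_and]
      intro x
      have := congrArg Prod.fst (hf x)
      exact this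
    have hq : p * g ∈ colGroup T := by
      simp only [colGroup, Finset.mem_filter, Finset.mem_univ, true_and]
      intro x
      have := congrArg Prod.snd (hf (g x))
      rw [← Perm.mul_apply g⁻¹, inv_mul_cancel, Perm.one_apply] at this
      exact this
    rw [← rowSum_mul_of T hp, mul_assoc (rowSum T), ← map_mul, mul_assoc, of_mul_colSum T hq,
      mul_smul_comm]
    exact Submodule.smul_mem _ _ (Submodule.mem_span_singleton_self _)

/-- `c_T x c_T` is a multiple of `c_T`. -/
lemma youngSymmetrizer_mul_mul (x : MonoidAlgebra ℂ (Perm α)) :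
    ∃ z : ℂ, youngSymmetrizer T * (x * youngSymmetrizer T) = z • youngSymmetrizer T := by
  have key : ∀ y : MonoidAlgebra ℂ (Perm α),
      rowSum T * y * colSum T ∈ Submodule.span ℂ {youngSymmetrizer T} := by
    intro y
    induction y using MonoidAlgebra.induction_on with
    | of g => exact rowSum_of_colSum T g
    | add y z hy hz =>
      rw [mul_add, add_mul]
      exact Submodule.add_mem _ hy hz
    | smul r y hy =>
      rw [mul_smul_comm, smul_mul_assoc]
      exact Submodule.smul_mem _ _ hy
  -- With `c_T` the row sum times the column sum, the inner column sum, `x` and the inner row sum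
  -- together form the middle factor.
  obtain ⟨z, hz⟩ := Submodule.mem_span_singleton.1 (key (colSum T * x * rowSum T))
  refine ⟨z, ?_⟩
  rw [hz, youngSymmetrizer_eq]
  simp only [mul_assoc]

end RectangleSpecht

/-! ### External tensor products of Specht modules -/

section External

variable {ι : Type} [Fintype ι] {G : ι → Type} [∀ h, Group (G h)] [∀ h, Finite (G h)]

variable (G) in
/-- The multilinear map from the group algebras of the factors to that of the product. -/
def piMul : MultilinearMap ℂ (fun h => MonoidAlgebra ℂ (G h)) (MonoidAlgebra ℂ (∀ h, G h)) :=
  ((Finsupp.linearEquivFunOnFinite ℂ ℂ (∀ h, G h)).symm.trans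
    (MonoidAlgebra.coeffLinearEquiv ℂ).symm).toLinearMap.compMultilinearMap
    (MultilinearMap.pi fun g => (MultilinearMap.mkPiAlgebra ℂ ι ℂ).compLinearMap fun h =>
      (Finsupp.lapply (g h)).comp
        (MonoidAlgebra.coeffLinearEquiv (S := ℂ) (M := G h) ℂ).toLinearMap)

lemma piMul_of (g : ∀ h, G h) :
    piMul G (fun h => MonoidAlgebra.of ℂ (G h) (g h)) = MonoidAlgebra.of ℂ _ g := by
  classical
  apply MonoidAlgebra.coeff_injective
  ext x
  have h1 : (piMul G fun h => MonoidAlgebra.of ℂ (G h) (g h)).coeff x =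
      ∏ h, (MonoidAlgebra.of ℂ (G h) (g h)).coeff (x h) := rfl
  rw [h1]
  simp only [MonoidAlgebra.of_apply, MonoidAlgebra.coeff_single, Finsupp.single_apply]
  rw [Finset.prod_ite_zero]
  simp [funext_iff]

omit [∀ h, Finite (G h)] in
lemma multilinear_ext_of {N : Type*} [AddCommGroup N] [Module ℂ N]
    {f f' : MultilinearMap ℂ (fun h => MonoidAlgebra ℂ (G h)) N}
    (h : ∀ g : ∀ h, G h, f (fun h => MonoidAlgebra.of ℂ (G h) (g h)) =
      f' fun h => MonoidAlgebra.of ℂ (G h) (g h)) : f = f' :=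
  Module.Basis.ext_multilinear
    (fun h => Module.Basis.ofRepr (MonoidAlgebra.coeffLinearEquiv (S := ℂ) (M := G h) ℂ)) h

/-- Both sides are multilinear in `x` and in `y`, so group elements suffice, treated one argument at
a time. -/
lemma piMul_mul (x y : ∀ h, MonoidAlgebra ℂ (G h)) :
    piMul G (x * y) = piMul G x * piMul G y := by
  have h1 : ∀ g : ∀ h, G h, ∀ x, piMul G (x * fun h => MonoidAlgebra.of ℂ (G h) (g h)) =
      piMul G x * MonoidAlgebra.of ℂ _ g := by
    intro g
    have := multilinear_ext_of (G := G)
      (f := (piMul G).compLinearMap fun h => LinearMap.mulRight ℂ (MonoidAlgebra.of ℂ (G h) (g h)))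
      (f' := (LinearMap.mulRight ℂ (MonoidAlgebra.of ℂ _ g)).compMultilinearMap (piMul G))
      fun g' => ?_
    · exact fun x => congrArg (fun f => f x) this
    · have h2 := piMul_of (g' * g)
      simp only [Pi.mul_apply, map_mul] at h2
      simpa only [MultilinearMap.compLinearMap_apply, LinearMap.mulRight_apply,
        LinearMap.compMultilinearMap_apply, piMul_of] using h2
  have := multilinear_ext_of (G := G)
      (f := (piMul G).compLinearMap fun h => LinearMap.mulLeft ℂ (x h))
      (f' := (LinearMap.mulLeft ℂ (piMul G x)).compMultilinearMap (piMul G))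
      fun g => ?_
  · exact congrArg (fun f => f y) this
  · change piMul G (x * fun h => MonoidAlgebra.of ℂ (G h) (g h)) =
      piMul G x * piMul G fun h => MonoidAlgebra.of ℂ (G h) (g h)
    rw [h1, piMul_of]

/-- Lets the symmetrizer of one block be applied through the restriction of `W` to that block. -/
lemma asAlgebraHom_piMul_mulSingle [DecidableEq ι] {M : Type*} [AddCommGroup M] [Module ℂ M]
    (W : Representation ℂ (∀ h, G h) M) (h : ι) (z : MonoidAlgebra ℂ (G h)) :
    W.asAlgebraHom (piMul G (Pi.mulSingle h z)) =
      Representation.asAlgebraHom (W.comp (MonoidHom.mulSingle G h)) z := by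
  induction z using MonoidAlgebra.induction_on with
  | of g =>
    have : (Pi.mulSingle h (MonoidAlgebra.of ℂ (G h) g) : ∀ h, MonoidAlgebra ℂ (G h)) =
        fun h' => MonoidAlgebra.of ℂ (G h') (Pi.mulSingle h g h') := by
      funext h'
      by_cases hh : h' = h
      · subst hh
        simp
      · rw [Pi.mulSingle_eq_of_ne hh, Pi.mulSingle_eq_of_ne hh, map_one]
    rw [this, piMul_of, Representation.asAlgebraHom_of, Representation.asAlgebraHom_of]
    rfl
  | add x y hx hy =>
    rw [map_add, ← hx, ← hy, ← map_add]
    congr 1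
    exact (piMul G).map_update_add 1 h x y
  | smul r x hx =>
    rw [map_smul, ← hx, ← map_smul]
    congr 1
    exact (piMul G).map_update_smul 1 h r x

variable {U : ι → Type*} [∀ h, AddCommGroup (U h)] [∀ h, Module ℂ (U h)]

lemma extTensor_tprod (ρ : ∀ h, Representation ℂ (G h) (U h)) (g : ∀ h, G h) (x : ∀ h, U h) :
    extTensor ρ g (PiTensorProduct.tprod ℂ x) = PiTensorProduct.tprod ℂ fun h => ρ h (g h) (x h) :=
  PiTensorProduct.map_tprod _ _

lemma asAlgebraHom_extTensor (ρ : ∀ h, Representation ℂ (G h) (U h))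
    (y : ∀ h, MonoidAlgebra ℂ (G h)) (x : ∀ h, U h) :
    (extTensor ρ).asAlgebraHom (piMul G y) (PiTensorProduct.tprod ℂ x) =
      PiTensorProduct.tprod ℂ fun h => (ρ h).asAlgebraHom (y h) (x h) := by
  have := multilinear_ext_of (G := G)
    (f := ((LinearMap.applyₗ (PiTensorProduct.tprod ℂ x)).comp
      (extTensor ρ).asAlgebraHom.toLinearMap).compMultilinearMap (piMul G))
    (f' := (PiTensorProduct.tprod ℂ).compLinearMap fun h =>
      (LinearMap.applyₗ (x h)).comp (ρ h).asAlgebraHom.toLinearMap) fun g => ?_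
  · exact congrArg (fun f => f y) this
  · simp [piMul_of, extTensor_tprod, -MonoidAlgebra.of_apply, Representation.asAlgebraHom_of]

end External

/-! ### A criterion for a map onto an irreducible representation to be bijective -/

lemma nontrivial_of_isIrreducible {G : Type*} [Monoid G] {M : Type*} [AddCommGroup M] [Module ℂ M]
    {ρ : Representation ℂ G M} (hρ : ρ.IsIrreducible) : Nontrivial M := by
  by_contra h
  rw [not_nontrivial_iff_subsingleton] at h
  exact bot_ne_top (α := Subrepresentation ρ)
    (Subrepresentation.toSubmodule_injective (Subsingleton.elim _ _))

/-- A map to an irreducible representation, from a representation generated by a vector `e` onto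
the line of which some element of the group algebra projects. -/
lemma bijective_of_line {G : Type*} [Group G] [Fintype G] {E M : Type*} [AddCommGroup E]
    [Module ℂ E] [AddCommGroup M] [Module ℂ M] {ρ : Representation ℂ G E}
    {W : Representation ℂ G M} (hW : W.IsIrreducible) (f : ρ.IntertwiningMap W) (hf : f ≠ 0)
    (x : MonoidAlgebra ℂ G) (e : E)
    (hgen : ∀ K : Submodule ℂ E, (∀ g, ∀ v ∈ K, ρ g v ∈ K) → e ∈ K → K = ⊤)
    (hx : ∀ v, ∃ z : ℂ, ρ.asAlgebraHom x v = z • e) (hxW : W.asAlgebraHom x ≠ 0) :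
    Function.Bijective f := by
  have hsurj : Function.Surjective f :=
    (Representation.IsIrreducible.surjective_or_eq_zero f).resolve_right hf
  have hcomm : ∀ v, f (ρ.asAlgebraHom x v) = W.asAlgebraHom x (f v) := by
    intro v
    clear hx hxW
    induction x using MonoidAlgebra.induction_on with
    | of g =>
      rw [Representation.asAlgebraHom_of, Representation.asAlgebraHom_of]
      exact Representation.IntertwiningMap.isIntertwining _ _ f g v
    | add x y hx hy =>
      rw [map_add, map_add, LinearMap.add_apply, LinearMap.add_apply, map_add, hx, hy]
    | smul r x hx =>
      rw [map_smul, map_smul, LinearMap.smul_apply, LinearMap.smul_apply, map_smul, hx]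
  -- By complete reducibility the kernel has a stable complement. Since `x` is nonzero on the image,
  -- it takes some vector of the complement to a nonzero multiple of `e`, so the complement is
  -- everything.
  obtain ⟨K', hK'⟩ := exists_isCompl f.ker
  obtain ⟨w, hw⟩ : ∃ w, W.asAlgebraHom x w ≠ 0 := by
    by_contra h
    push Not at h
    exact hxW (LinearMap.ext h)
  obtain ⟨v, rfl⟩ := hsurj w
  have hsup : v ∈ f.ker ⊔ K' := by
    rw [hK'.sup_eq_top]
    trivial
  obtain ⟨k, hk, k', hk', rfl⟩ := Submodule.mem_sup.1 hsup
  have hk0 : f k = 0 := hk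
  rw [map_add, hk0, zero_add, ← hcomm] at hw
  obtain ⟨z, hz⟩ := hx k'
  have hz0 : z ≠ 0 := by
    rintro rfl
    rw [hz, zero_smul, map_zero] at hw
    exact hw rfl
  have he : e ∈ K'.toSubmodule := by
    have h1 := Representation.asAlgebraHom_mem_of_forall_mem ρ K'.toSubmodule
      (fun g v hv => K'.apply_mem_toSubmodule g hv) k' hk' x
    rw [hz] at h1
    simpa [smul_smul, inv_mul_cancel₀ hz0] using K'.toSubmodule.smul_mem z⁻¹ h1
  have htop := hgen K'.toSubmodule (fun g v hv => K'.apply_mem_toSubmodule g hv) he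
  refine ⟨(injective_iff_map_eq_zero f).2 fun v hv => ?_, hsurj⟩
  have h2 : v ∈ f.ker ⊓ K' := ⟨hv, by
    change v ∈ K'.toSubmodule
    rw [htop]
    trivial⟩
  rw [hK'.inf_eq_bot] at h2
  exact h2

/-! ### Irreducible representations of the inertia factor -/

section Inertia

variable {ν : ℕ} {n : Fin ν → ℕ} {U : Type*} [AddCommGroup U] [Module ℂ U]
  (W : Representation ℂ (InertiaFactor n) U)

/-- The restriction of a representation of the inertia factor to one of the blocks. -/
abbrev blockRep (h : Fin ν) : Representation ℂ (Perm (Fin (n h))) U :=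
  W.comp (MonoidHom.mulSingle (fun h => Perm (Fin (n h))) h)

variable {a b : Fin ν → ℕ} (T : ∀ h, Fin (n h) ≃ {x // x ∈ (rectDiagram (a h) (b h)).cells})

/-- Blocks are added one at a time. The range of the product so far is stable under the new block,
whose operators commute with it, so the nonvanishing result for one symmetric group applies to that
range. -/
lemma exists_prod_youngSymmetrizer_apply_ne_zero [Nontrivial U]
    (hW : ∀ h, ∀ v, SwapSumsActBy (blockRep W h) Finset.univ ((b h : ℂ) - a h) v)
    (S : Finset (Fin ν)) :
    ∃ v, W.asAlgebraHom (piMul (fun h => Perm (Fin (n h)))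
      fun h => if h ∈ S then youngSymmetrizer (T h) else 1) v ≠ 0 := by
  induction S using Finset.induction_on with
  | empty =>
    obtain ⟨v, hv⟩ := exists_ne (0 : U)
    refine ⟨v, ?_⟩
    have := piMul_of (G := fun h => Perm (Fin (n h))) 1
    simp only [Pi.one_apply, map_one] at this
    simp only [Finset.notMem_empty, if_false, this, map_one]
    exact hv
  | insert h S hS ih =>
    obtain ⟨v, hv⟩ := ih
    set X := piMul (fun h => Perm (Fin (n h)))
      fun h => if h ∈ S then youngSymmetrizer (T h) else 1 with hX
    let K : Submodule ℂ U := LinearMap.range (W.asAlgebraHom X)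
    have hcomm : ∀ (z : MonoidAlgebra ℂ (Perm (Fin (n h)))) u,
        Representation.asAlgebraHom (blockRep W h) z (W.asAlgebraHom X u) =
          W.asAlgebraHom X (Representation.asAlgebraHom (blockRep W h) z u) := by
      intro z u
      have hpi : (Pi.mulSingle h z * fun h => if h ∈ S then youngSymmetrizer (T h) else 1 :
          ∀ h, MonoidAlgebra ℂ (Perm (Fin (n h)))) =
          (fun h => if h ∈ S then youngSymmetrizer (T h) else 1) * Pi.mulSingle h z := by
        funext h'
        by_cases hh : h' = h
        · subst hh
          rw [Pi.mul_apply, Pi.mul_apply, if_neg hS, mul_one, one_mul]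
        · rw [Pi.mul_apply, Pi.mul_apply, Pi.mulSingle_eq_of_ne hh, mul_one, one_mul]
      rw [← asAlgebraHom_piMul_mulSingle, ← Module.End.mul_apply, ← Module.End.mul_apply,
        ← map_mul W.asAlgebraHom, ← map_mul W.asAlgebraHom, hX, ← piMul_mul, ← piMul_mul, hpi]
    obtain ⟨_, ⟨u, rfl⟩, hu⟩ := exists_youngSymmetrizer_apply_ne_zero (T h) (hW h) (K := K)
      (by
        rintro g _ ⟨u, rfl⟩
        refine ⟨blockRep W h g u, ?_⟩
        have := hcomm (MonoidAlgebra.of ℂ _ g) u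
        rw [Representation.asAlgebraHom_of] at this
        exact this.symm)
      (K.ne_bot_iff.2 ⟨_, ⟨v, rfl⟩, hv⟩)
    refine ⟨u, ?_⟩
    rw [← asAlgebraHom_piMul_mulSingle, ← Module.End.mul_apply,
      ← map_mul W.asAlgebraHom, ← piMul_mul] at hu
    have hpi : (Pi.mulSingle h (youngSymmetrizer (T h)) * fun h =>
        if h ∈ S then youngSymmetrizer (T h) else 1 : ∀ h, MonoidAlgebra ℂ (Perm (Fin (n h)))) =
        fun h' => if h' ∈ insert h S then youngSymmetrizer (T h') else 1 := by
      funext h'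
      by_cases hh : h' = h
      · subst hh
        rw [Pi.mul_apply, if_neg hS, mul_one, Pi.mulSingle_eq_same,
          if_pos (Finset.mem_insert_self _ _)]
      · rw [Pi.mul_apply, Pi.mulSingle_eq_of_ne hh, one_mul]
        simp only [Finset.mem_insert, hh, false_or]
    rwa [hpi] at hu

/-- The generator of the external tensor product of the Specht modules. -/
def extGen : PiTensorProduct ℂ fun h => SpechtModule (T h) :=
  PiTensorProduct.tprod ℂ fun h => spechtGen (T h)

lemma eq_top_of_extGen_mem (K : Submodule ℂ (PiTensorProduct ℂ fun h => SpechtModule (T h)))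
    (hK : ∀ g, ∀ v ∈ K, extTensor (fun h => spechtRep (T h)) g v ∈ K) (he : extGen T ∈ K) :
    K = ⊤ := by
  rw [eq_top_iff, ← PiTensorProduct.span_tprod_eq_top, Submodule.span_le]
  rintro _ ⟨x, rfl⟩
  choose y hy using fun h => exists_eq_asAlgebraHom_spechtGen (T h) (x h)
  have h1 := Representation.asAlgebraHom_mem_of_forall_mem _ K hK _ he
    (piMul (fun h => Perm (Fin (n h))) y)
  rw [extGen, asAlgebraHom_extTensor] at h1
  simp only [← hy] at h1
  exact h1

/-- On pure tensors this is `c_T y c_T ∈ ℂ c_T` in each factor, the scalars multiplying. -/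
lemma asAlgebraHom_youngSymmetrizer_extTensor (v : PiTensorProduct ℂ fun h => SpechtModule (T h)) :
    ∃ z : ℂ, (extTensor fun h => spechtRep (T h)).asAlgebraHom
      (piMul (fun h => Perm (Fin (n h))) fun h => youngSymmetrizer (T h)) v = z • extGen T := by
  have key : (⊤ : Submodule ℂ _) ≤ (Submodule.span ℂ {extGen T}).comap
      ((extTensor fun h => spechtRep (T h)).asAlgebraHom
        (piMul (fun h => Perm (Fin (n h))) fun h => youngSymmetrizer (T h))) := by
    rw [← PiTensorProduct.span_tprod_eq_top, Submodule.span_le]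
    rintro _ ⟨x, rfl⟩
    choose y hy using fun h => exists_eq_asAlgebraHom_spechtGen (T h) (x h)
    choose z hz using fun h => youngSymmetrizer_mul_mul (T h) (y h)
    refine Submodule.mem_span_singleton.2 ⟨∏ h, z h, ?_⟩
    rw [asAlgebraHom_extTensor, extGen, ← MultilinearMap.map_smul_univ]
    congr 1
    funext h
    apply Subtype.ext
    rw [coe_asAlgebraHom_spechtRep, hy, coe_asAlgebraHom_spechtRep]
    exact (hz h).symm
  obtain ⟨z, hz⟩ := Submodule.mem_span_singleton.1 (key (Submodule.mem_top (x := v)))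
  exact ⟨z, hz.symm⟩

/-- The intertwining map sending the generator of the external tensor product to the vector that
the product of the Young symmetrizers makes of `w`. -/
def ofExtTensor (w : U) : (extTensor fun h => spechtRep (T h)).IntertwiningMap W where
  toLinearMap := PiTensorProduct.lift
    ((((LinearMap.applyₗ w).comp W.asAlgebraHom.toLinearMap).compMultilinearMap
      (piMul fun h => Perm (Fin (n h)))).compLinearMap fun h =>
        (SpechtModule (T h)).subtype.restrictScalars ℂ)
  isIntertwining' g := by
    ext x
    simp only [LinearMap.compMultilinearMap_apply, LinearMap.comp_apply, extTensor_tprod,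
      PiTensorProduct.lift.tprod, MultilinearMap.compLinearMap_apply]
    change W.asAlgebraHom (piMul (fun h => Perm (Fin (n h)))
      ((fun h => MonoidAlgebra.of ℂ _ (g h)) * fun h => (x h).1)) w = W g
        (W.asAlgebraHom (piMul (fun h => Perm (Fin (n h))) fun h => (x h).1) w)
    rw [piMul_mul, piMul_of, map_mul, Representation.asAlgebraHom_of, Module.End.mul_apply]

lemma ofExtTensor_extGen (w : U) : ofExtTensor W T w (extGen T) =
    W.asAlgebraHom (piMul (fun h => Perm (Fin (n h))) fun h => youngSymmetrizer (T h)) w :=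
  PiTensorProduct.lift.tprod _

/-- An irreducible representation on which the sums of transpositions act by the scalars of
rectangles is the external tensor product of their Specht modules. -/
lemma nonempty_equiv_extTensor (hWirr : W.IsIrreducible)
    (hW : ∀ h, ∀ v, SwapSumsActBy (blockRep W h) Finset.univ ((b h : ℂ) - a h) v) :
    Nonempty (W.Equiv (extTensor fun h => spechtRep (T h))) := by
  have : Nontrivial U := nontrivial_of_isIrreducible hWirr
  obtain ⟨w, hw⟩ := exists_prod_youngSymmetrizer_apply_ne_zero W T hW Finset.univ
  simp only [Finset.mem_univ, if_true] at hw
  have hline := asAlgebraHom_youngSymmetrizer_extTensor T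
  have hgen := eq_top_of_extGen_mem T
  have hf := ofExtTensor_extGen W T w
  generalize ofExtTensor W T w = f at hf
  generalize piMul (fun h => Perm (Fin (n h))) (fun h => youngSymmetrizer (T h)) = X at *
  generalize extGen T = e at *
  generalize extTensor (fun h => spechtRep (T h)) = ρ at *
  have hf0 : f ≠ 0 := by
    rintro rfl
    exact hw hf.symm
  have hne : W.asAlgebraHom X ≠ 0 := by
    intro h0
    rw [h0] at hw
    exact hw (LinearMap.zero_apply w)
  have hbij : Function.Bijective f := by
    refine bijective_of_line hWirr f hf0 X e hgen ?_ hne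
    exact hline
  exact ⟨(f.ofBijective hbij).symm⟩

/-- On the external tensor product of the Specht modules of rectangles, the sums of transpositions
act by scalars. -/
lemma swapSumsActBy_of_equiv (φ : W.Equiv (extTensor fun h => spechtRep (T h))) (h : Fin ν)
    (v : U) : SwapSumsActBy (blockRep W h) Finset.univ ((b h : ℂ) - a h) v := by
  intro i _
  have key : ∑ j ∈ Finset.univ.erase i,
      extTensor (fun h => spechtRep (T h)) (Pi.mulSingle h (swap i j)) =
        ((b h : ℂ) - a h) • LinearMap.id := by
    ext x
    simp only [LinearMap.compMultilinearMap_apply, LinearMap.sum_apply, extTensor_tprod,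
      LinearMap.smul_apply, LinearMap.id_apply]
    have h1 : ∀ j, (fun h' => spechtRep (T h') ((Pi.mulSingle h (swap i j) : InertiaFactor n) h')
        (x h')) = Function.update x h (spechtRep (T h) (swap i j) (x h)) := by
      intro j
      funext h'
      by_cases hh : h' = h
      · subst hh
        simp
      · simp [Pi.mulSingle_eq_of_ne hh, Function.update_of_ne hh]
    simp only [h1]
    rw [← MultilinearMap.map_update_sum,
      swapSumsActBy_spechtRep (T h) (x h) i (Finset.mem_univ i), MultilinearMap.map_update_smul,
      Function.update_eq_self]
  apply φ.toLinearEquiv.injective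
  rw [map_sum, map_smul]
  have h2 : ∀ g u, φ.toLinearEquiv (W g u) =
      extTensor (fun h => spechtRep (T h)) g (φ.toLinearEquiv u) := fun g u =>
    Representation.IntertwiningMap.isIntertwining _ _ φ.toIntertwiningMap g u
  have h3 := congrArg (fun f => f (φ.toLinearEquiv v)) key
  simp only [LinearMap.sum_apply, LinearMap.smul_apply, LinearMap.id_apply] at h3
  rw [← h3]
  exact Finset.sum_congr rfl fun j _ => h2 _ v

end Inertia

/-! ### Schur orthogonality -/

section Schur

variable {G : Type*} [Group G] [Fintype G] {V V' : Type*} [AddCommGroup V] [Module ℂ V]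
  [AddCommGroup V'] [Module ℂ V'] {ρ : Representation ℂ G V} {ρ' : Representation ℂ G V'}

/-- The finite orbit of any nonzero vector spans a nonzero stable subspace. -/
lemma finiteDimensional_of_isIrreducible (hρ : ρ.IsIrreducible) : FiniteDimensional ℂ V := by
  have := nontrivial_of_isIrreducible hρ
  obtain ⟨v, hv⟩ := exists_ne (0 : V)
  let K : Subrepresentation ρ :=
    { toSubmodule := Submodule.span ℂ (Set.range fun g => ρ g v)
      apply_mem_toSubmodule := by
        intro g w hw
        induction hw using Submodule.span_induction with
        | mem x hx =>
          obtain ⟨g', rfl⟩ := hx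
          exact Submodule.subset_span ⟨g * g', by simp⟩
        | zero => rw [map_zero]; exact Submodule.zero_mem _
        | add x y _ _ hx hy => rw [map_add]; exact Submodule.add_mem _ hx hy
        | smul c x _ hx => rw [map_smul]; exact Submodule.smul_mem _ c hx }
  have hvK : v ∈ K.toSubmodule := Submodule.subset_span ⟨1, by simp⟩
  rcases eq_bot_or_eq_top K with h | h
  · rw [h] at hvK
    exact absurd hvK hv
  · have h1 : Submodule.span ℂ (Set.range fun g => ρ g v) = ⊤ :=
      congrArg Subrepresentation.toSubmodule h
    exact ⟨h1 ▸ Submodule.fg_span (Set.finite_range _)⟩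

lemma finrank_ne_zero_of_isIrreducible (hρ : ρ.IsIrreducible) :
    (Module.finrank ℂ V : ℂ) ≠ 0 := by
  have := finiteDimensional_of_isIrreducible hρ
  have := nontrivial_of_isIrreducible hρ
  exact_mod_cast (Module.finrank_pos (R := ℂ) (M := V)).ne'

/-- An endomorphism commuting with an irreducible representation is the scalar given by its
trace. -/
lemma eq_trace_smul_of_commute (hρ : ρ.IsIrreducible) (f : V →ₗ[ℂ] V)
    (hf : ∀ g v, f (ρ g v) = ρ g (f v)) :
    f = (LinearMap.trace ℂ V f / Module.finrank ℂ V) • LinearMap.id := by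
  have := finiteDimensional_of_isIrreducible hρ
  obtain ⟨z, hz⟩ :=
    (Representation.IsIrreducible.algebraMap_intertwiningMap_bijective_of_isAlgClosed (ρ := ρ)).2
      ⟨f, fun g => LinearMap.ext (hf g)⟩
  have hfz : f = z • LinearMap.id := by
    have := congrArg Representation.IntertwiningMap.toLinearMap hz
    exact this.symm
  rw [hfz, map_smul, LinearMap.trace_id, smul_eq_mul,
    mul_div_cancel_right₀ _ (finrank_ne_zero_of_isIrreducible hρ)]

lemma sum_conj_apply (A : V' →ₗ[ℂ] V) (g : G) (v : V') :
    ∑ γ, ρ γ (A (ρ' γ⁻¹ (ρ' g v))) = ρ g (∑ γ, ρ γ (A (ρ' γ⁻¹ v))) := by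
  rw [map_sum]
  refine (Fintype.sum_equiv (Equiv.mulLeft g) _ _ fun γ => ?_).symm
  rw [Equiv.coe_mulLeft, mul_inv_rev, map_mul, map_mul, Module.End.mul_apply,
    Module.End.mul_apply, ← Module.End.mul_apply (ρ' g⁻¹), ← map_mul, inv_mul_cancel, map_one,
    Module.End.one_apply]

/-- Schur orthogonality for one irreducible representation. -/
lemma sum_bilin_self (hρ : ρ.IsIrreducible) {Z : Type*} [AddCommGroup Z] [Module ℂ Z]
    (B : V →ₗ[ℂ] V →ₗ[ℂ] Z) (v w : V) :
    ∑ γ, B (ρ γ v) (ρ γ⁻¹ w) = ((Fintype.card G : ℂ) / Module.finrank ℂ V) • B w v := by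
  have := finiteDimensional_of_isIrreducible hρ
  -- Averaging the rank-one map `w ↦ f w • v` over the group gives an intertwiner, a scalar by
  -- Schur's lemma; each conjugate has trace `f v`.
  have key : ∀ f : V →ₗ[ℂ] ℂ, ∑ γ, f (ρ γ⁻¹ w) • ρ γ v =
      (Fintype.card G * f v / Module.finrank ℂ V) • w := by
    intro f
    have h1 := eq_trace_smul_of_commute hρ
      (∑ γ, ρ γ ∘ₗ (LinearMap.smulRight f v) ∘ₗ ρ γ⁻¹) fun g x => by
        simpa only [LinearMap.sum_apply, LinearMap.comp_apply] using
          sum_conj_apply (ρ := ρ) (ρ' := ρ) (LinearMap.smulRight f v) g x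
    have h2 : ∀ γ, LinearMap.trace ℂ V (ρ γ ∘ₗ (LinearMap.smulRight f v) ∘ₗ ρ γ⁻¹) = f v := by
      intro γ
      rw [LinearMap.trace_comp_comm', LinearMap.comp_assoc, ← Module.End.mul_eq_comp (ρ γ⁻¹),
        ← map_mul, inv_mul_cancel, map_one, Module.End.one_eq_id, LinearMap.comp_id,
        LinearMap.trace_smulRight]
    have h3 := congrArg (fun F => F w) h1
    simp only [LinearMap.sum_apply, LinearMap.comp_apply, map_sum, h2, Finset.sum_const,
      Finset.card_univ, nsmul_eq_mul, LinearMap.smulRight_apply, map_smul, LinearMap.smul_apply,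
      LinearMap.id_apply] at h3
    exact h3
  let b := Module.finBasis ℂ V
  have h4 : ∀ γ, B (ρ γ v) (ρ γ⁻¹ w) = ∑ a, B (b.coord a (ρ γ⁻¹ w) • ρ γ v) (b a) := by
    intro γ
    conv_lhs => rw [← b.sum_repr (ρ γ⁻¹ w)]
    simp only [map_sum, map_smul, LinearMap.smul_apply, Module.Basis.coord_apply]
  simp only [h4]
  rw [Finset.sum_comm]
  have h5 : ∀ a, ∑ γ, B (b.coord a (ρ γ⁻¹ w) • ρ γ v) (b a) =
      ((Fintype.card G : ℂ) / Module.finrank ℂ V) • B w (b.repr v a • b a) := by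
    intro a
    rw [← LinearMap.sum_apply, ← map_sum, key, map_smul, LinearMap.smul_apply, map_smul, smul_smul,
      Module.Basis.coord_apply]
    congr 1
    ring
  simp only [h5]
  rw [← Finset.smul_sum, ← map_sum, b.sum_repr]

/-- Schur orthogonality for two non-isomorphic irreducible representations. -/
lemma sum_bilin_of_isEmpty_equiv (hρ : ρ.IsIrreducible) (hρ' : ρ'.IsIrreducible)
    (hne : IsEmpty (ρ'.Equiv ρ)) {Z : Type*} [AddCommGroup Z] [Module ℂ Z]
    (B : V →ₗ[ℂ] V' →ₗ[ℂ] Z) (v : V) (w : V') : ∑ γ, B (ρ γ v) (ρ' γ⁻¹ w) = 0 := by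
  have := finiteDimensional_of_isIrreducible hρ'
  have key : ∀ f : V' →ₗ[ℂ] ℂ, ∑ γ, f (ρ' γ⁻¹ w) • ρ γ v = 0 := by
    intro f
    let F : ρ'.IntertwiningMap ρ :=
      ⟨∑ γ, ρ γ ∘ₗ (LinearMap.smulRight f v) ∘ₗ ρ' γ⁻¹, fun g => LinearMap.ext fun x => by
        simpa only [LinearMap.sum_apply, LinearMap.comp_apply] using
          sum_conj_apply (ρ := ρ) (ρ' := ρ') (LinearMap.smulRight f v) g x⟩
    have hF : F = 0 := Subsingleton.elim _ _
    have h3 : F.toLinearMap w = 0 := by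
      rw [hF]
      rfl
    simpa only [F, LinearMap.sum_apply, LinearMap.comp_apply, LinearMap.smulRight_apply,
      map_smul] using h3
  let b := Module.finBasis ℂ V'
  have h4 : ∀ γ, B (ρ γ v) (ρ' γ⁻¹ w) = ∑ a, B (b.coord a (ρ' γ⁻¹ w) • ρ γ v) (b a) := by
    intro γ
    conv_lhs => rw [← b.sum_repr (ρ' γ⁻¹ w)]
    simp only [map_sum, map_smul, LinearMap.smul_apply, Module.Basis.coord_apply]
  simp only [h4]
  rw [Finset.sum_comm]
  refine Finset.sum_eq_zero fun a _ => ?_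
  rw [← LinearMap.sum_apply, ← map_sum, key, map_zero, LinearMap.zero_apply]

/-- A class function acts by a scalar. -/
lemma sum_classFunction_apply (hρ : ρ.IsIrreducible) {c : G → ℂ}
    (hc : ∀ g γ, c (g * γ * g⁻¹) = c γ) (s : Finset G)
    (hs : ∀ g γ, g * γ * g⁻¹ ∈ s ↔ γ ∈ s) (v : V) :
    ∑ γ ∈ s, c γ • ρ γ v = ((∑ γ ∈ s, c γ * ρ.character γ) / Module.finrank ℂ V) • v := by
  have h1 := eq_trace_smul_of_commute hρ (∑ γ ∈ s, c γ • ρ γ) fun g v => by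
    simp only [LinearMap.sum_apply, LinearMap.smul_apply, map_sum, map_smul]
    refine (Finset.sum_equiv (MulAut.conj g).toEquiv (fun γ => ?_) fun γ _ => ?_).symm
    · exact (hs g γ).symm
    · change _ = c (g * γ * g⁻¹) • ρ (g * γ * g⁻¹) (ρ g v)
      rw [hc, ← Module.End.mul_apply, ← Module.End.mul_apply, ← map_mul, ← map_mul,
        inv_mul_cancel_right]
  have h2 := congrArg (fun F => F v) h1
  simp only [LinearMap.sum_apply, LinearMap.smul_apply, map_sum, map_smul, smul_eq_mul,
    LinearMap.id_apply] at h2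
  exact h2

end Schur

lemma exists_dual_apply_ne_zero {V : Type*} [AddCommGroup V] [Module ℂ V] {v : V} (hv : v ≠ 0) :
    ∃ f : Module.Dual ℂ V, f v ≠ 0 := by
  by_contra h
  push Not at h
  exact hv ((Module.forall_dual_apply_eq_zero_iff ℂ v).1 h)

/-- A product of functionals, one nonzero on each factor, detects the pure tensor. -/
lemma tprod_ne_zero {ι : Type*} [Fintype ι] {V : ι → Type*} [∀ i, AddCommGroup (V i)]
    [∀ i, Module ℂ (V i)] {x : ∀ i, V i} (hx : ∀ i, x i ≠ 0) :
    PiTensorProduct.tprod ℂ x ≠ 0 := by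
  choose f hf using fun i => exists_dual_apply_ne_zero (hx i)
  intro h0
  have h1 := PiTensorProduct.dualDistrib_apply f x
  rw [h0, map_zero] at h1
  exact Finset.prod_ne_zero_iff.2 (fun i _ => hf i) h1.symm

/-! ### The representation `Y` -/

section YSpace

variable {ν : ℕ} {n : Fin ν → ℕ} {V : Fin ν → Type*} [∀ h, AddCommGroup (V h)]
  [∀ h, Module ℂ (V h)]

/-- The pure tensors of `YSpace`. -/
def yTensor (x : ∀ i : Pos n, V i.1) : YSpace n V :=
  PiTensorProduct.tprod ℂ fun h => PiTensorProduct.tprod ℂ fun p => x ⟨h, p⟩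

/-- Changing one position is an update inside the inner tensor of its block; linearity in each
position then follows from that of the two nested tensor products. -/
lemma yTensor_update (x : ∀ i : Pos n, V i.1) (h : Fin ν) (p : Fin (n h)) (v : V h) :
    yTensor (Function.update x ⟨h, p⟩ v) = PiTensorProduct.tprod ℂ (Function.update
      (fun h => PiTensorProduct.tprod ℂ fun p => x ⟨h, p⟩) h
      (PiTensorProduct.tprod ℂ (Function.update (fun p => x ⟨h, p⟩) p v))) := by
  unfold yTensor
  congr 1
  funext h'
  by_cases hh : h' = h
  · subst hh
    rw [Function.update_self]
    congr 1
    funext q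
    by_cases hq : q = p
    · subst hq
      rw [Function.update_self, Function.update_self]
    · rw [Function.update_of_ne hq, Function.update_of_ne]
      simpa using hq
  · rw [Function.update_of_ne hh]
    congr 1
    funext q
    rw [Function.update_of_ne]
    intro hq
    exact hh (congrArg Sigma.fst hq)

/-- A pure tensor of `YSpace` as a linear function of one factor. -/
def yTensorAt (x : ∀ i : Pos n, V i.1) (i : Pos n) : V i.1 →ₗ[ℂ] YSpace n V where
  toFun v := yTensor (Function.update x i v)
  map_add' v w := by
    obtain ⟨h, p⟩ := i
    rw [yTensor_update, yTensor_update, yTensor_update, MultilinearMap.map_update_add,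
      MultilinearMap.map_update_add]
  map_smul' z v := by
    obtain ⟨h, p⟩ := i
    rw [yTensor_update, yTensor_update, MultilinearMap.map_update_smul,
      MultilinearMap.map_update_smul, RingHom.id_apply]

lemma yTensorAt_apply (x : ∀ i : Pos n, V i.1) (i : Pos n) (v : V i.1) :
    yTensorAt x i v = yTensor (Function.update x i v) := rfl

/-- A pure tensor of `YSpace` as a bilinear function of two factors. -/
def yTensorAt₂ (x : ∀ i : Pos n, V i.1) {i j : Pos n} (hij : i ≠ j) :
    V i.1 →ₗ[ℂ] V j.1 →ₗ[ℂ] YSpace n V :=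
  LinearMap.mk₂ ℂ (fun v w => yTensor (Function.update (Function.update x i v) j w))
    (fun v v' w => by
      simp only [Function.update_comm hij, ← yTensorAt_apply, map_add])
    (fun z v w => by
      simp only [Function.update_comm hij, ← yTensorAt_apply, map_smul])
    (fun v w w' => by
      simp only [← yTensorAt_apply, map_add])
    (fun z v w => by
      simp only [← yTensorAt_apply, map_smul])

lemma yTensorAt₂_apply (x : ∀ i : Pos n, V i.1) {i j : Pos n} (hij : i ≠ j) (v : V i.1)
    (w : V j.1) :
    yTensorAt₂ x hij v w = yTensor (Function.update (Function.update x i v) j w) := rfl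

lemma ySpace_hom_ext [∀ h, FiniteDimensional ℂ (V h)] {Z : Type*} [AddCommGroup Z] [Module ℂ Z]
    {f g : YSpace n V →ₗ[ℂ] Z} (hfg : ∀ x : ∀ i : Pos n, V i.1, f (yTensor x) = g (yTensor x)) :
    f = g := by
  apply PiTensorProduct.ext
  refine Module.Basis.ext_multilinear
    (fun h => Basis.piTensorProduct fun _ : Fin (n h) => Module.finBasis ℂ (V h)) fun κ => ?_
  simp only [LinearMap.compMultilinearMap_apply, Basis.piTensorProduct_apply]
  exact hfg fun i => Module.finBasis ℂ (V i.1) (κ i.1 i.2)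

lemma nontrivial_ySpace [∀ h, Nontrivial (V h)] : Nontrivial (YSpace n V) := by
  choose v hv using fun h => exists_ne (0 : V h)
  exact nontrivial_of_ne _ 0
    (tprod_ne_zero fun h => tprod_ne_zero (x := fun _ : Fin (n h) => v h) fun _ => hv h)

variable {Γ : Type} [Group Γ] (Y : ∀ h, Representation ℂ Γ (V h))

lemma yRep_yTensor (s : Inertia Γ n) (x : ∀ i : Pos n, V i.1) :
    yRep Y s (yTensor x) =
      yTensor fun i => Y i.1 (s.left i) (x ⟨i.1, (s.right i.1)⁻¹ i.2⟩) := by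
  change PiTensorProduct.map _ _ = _
  rw [yTensor, PiTensorProduct.map_tprod]
  unfold yTensor
  congr 1
  funext h
  rw [LinearMap.comp_apply, LinearEquiv.coe_coe, PiTensorProduct.reindex_tprod,
    PiTensorProduct.map_tprod]
  rfl

/-- The element `γ` in the `i`-th factor, in the inertia group. -/
def inertiaEmbAt (i : Pos n) (γ : Γ) : Inertia Γ n := SemidirectProduct.inl (Pi.mulSingle i γ)

variable (Γ) in
/-- The transposition of two positions of a block, in the inertia group. -/
def inertiaTransp (h : Fin ν) (p q : Fin (n h)) : Inertia Γ n :=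
  SemidirectProduct.inr (Pi.mulSingle h (swap p q))

lemma yRep_inertiaEmbAt (i : Pos n) (γ : Γ) (x : ∀ i : Pos n, V i.1) :
    yRep Y (inertiaEmbAt i γ) (yTensor x) =
      yTensor (Function.update x i (Y i.1 γ (x i))) := by
  rw [yRep_yTensor]
  congr 1
  funext j
  by_cases hij : j = i
  · subst hij
    simp [inertiaEmbAt]
    rfl
  · simp [inertiaEmbAt, Pi.mulSingle_eq_of_ne hij, Function.update_of_ne hij]
    rfl

/-- The argument is the flipped pure tensor that Schur orthogonality produces; the transposition
restores the original. -/
lemma yRep_inertiaTransp (h : Fin ν) {p q : Fin (n h)} (hpq : p ≠ q) (x : ∀ i : Pos n, V i.1) :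
    yRep Y (inertiaTransp Γ h p q) (yTensor (Function.update
      (Function.update x ⟨h, p⟩ (x ⟨h, q⟩)) ⟨h, q⟩ (x ⟨h, p⟩))) = yTensor x := by
  rw [yRep_yTensor]
  congr 1
  funext ⟨h', r⟩
  simp only [inertiaTransp, SemidirectProduct.left_inr, Pi.one_apply, map_one,
    Module.End.one_apply, SemidirectProduct.right_inr]
  set F := Function.update (Function.update x ⟨h, p⟩ (x ⟨h, q⟩)) ⟨h, q⟩ (x ⟨h, p⟩) with hF
  by_cases hh : h' = h
  · subst hh
    have hne : (⟨h', p⟩ : Pos n) ≠ ⟨h', q⟩ := by simpa using hpq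
    refine (congrArg (β := V h') (fun t => F ⟨h', t⟩)
      (show ((Pi.mulSingle h' (swap p q) : InertiaFactor n) h')⁻¹ r = swap p q r by
        rw [Pi.mulSingle_eq_same, swap_inv])).trans ?_
    by_cases hrp : r = p
    · subst hrp
      rw [swap_apply_left, hF, Function.update_self]
    by_cases hrq : r = q
    · subst hrq
      rw [swap_apply_right, hF, Function.update_of_ne hne, Function.update_self]
    rw [swap_apply_of_ne_of_ne hrp hrq, hF, Function.update_of_ne (by simpa using hrq),
      Function.update_of_ne (by simpa using hrp)]
  · refine (congrArg (β := V h') (fun t => F ⟨h', t⟩)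
      (show ((Pi.mulSingle h (swap p q) : InertiaFactor n) h')⁻¹ r = r by
        rw [Pi.mulSingle_eq_of_ne hh, inv_one, Perm.one_apply])).trans ?_
    rw [hF, Function.update_of_ne (fun e => hh (congrArg Sigma.fst e)),
      Function.update_of_ne (fun e => hh (congrArg Sigma.fst e))]

lemma yRep_embAt_mul_inv {i j : Pos n} (hij : i ≠ j) (γ : Γ) (x : ∀ i : Pos n, V i.1) :
    yRep Y (inertiaEmbAt i γ * (inertiaEmbAt j γ)⁻¹) (yTensor x) =
      yTensorAt₂ x hij (Y i.1 γ (x i)) (Y j.1 γ⁻¹ (x j)) := by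
  have h1 : (inertiaEmbAt j γ : Inertia Γ n)⁻¹ = inertiaEmbAt j γ⁻¹ := by
    rw [inertiaEmbAt, inertiaEmbAt, ← map_inv, Pi.mulSingle_inv]
  rw [h1, map_mul, Module.End.mul_apply, yRep_inertiaEmbAt, yRep_inertiaEmbAt, yTensorAt₂_apply,
    Function.update_comm hij, Function.update_of_ne hij]

variable [Fintype Γ] (hY : ∀ h, (Y h).IsIrreducible)

include hY

lemma sum_yRep_of_ne (hYne : ∀ h h', h ≠ h' → IsEmpty ((Y h).Equiv (Y h')))
    {i j : Pos n} (hij : i.1 ≠ j.1) :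
    ∑ γ : Γ, yRep Y (inertiaEmbAt i γ * (inertiaEmbAt j γ)⁻¹) = 0 := by
  have := fun h => finiteDimensional_of_isIrreducible (hY h)
  refine ySpace_hom_ext fun x => ?_
  rw [LinearMap.sum_apply, LinearMap.zero_apply]
  simp only [yRep_embAt_mul_inv Y (fun e => hij (congrArg Sigma.fst e))]
  exact sum_bilin_of_isEmpty_equiv (hY i.1) (hY j.1) (hYne _ _ hij.symm) _ _ _

/-- The sum of `γ ⊗ γ⁻¹` is `|Γ| / dim` times the flip, which the transposition cancels. -/
lemma sum_yRep_block (h : Fin ν) {p q : Fin (n h)} (hpq : p ≠ q) :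
    ∑ γ : Γ, yRep Y (inertiaTransp Γ h p q * inertiaEmbAt ⟨h, p⟩ γ * (inertiaEmbAt ⟨h, q⟩ γ)⁻¹) =
      ((Fintype.card Γ : ℂ) / Module.finrank ℂ (V h)) • LinearMap.id := by
  have := fun h => finiteDimensional_of_isIrreducible (hY h)
  have hne : (⟨h, p⟩ : Pos n) ≠ ⟨h, q⟩ := by simpa using hpq
  refine ySpace_hom_ext fun x => ?_
  rw [LinearMap.sum_apply, LinearMap.smul_apply, LinearMap.id_apply]
  simp only [mul_assoc, map_mul (yRep Y) (inertiaTransp Γ h p q), Module.End.mul_apply,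
    yRep_embAt_mul_inv Y hne]
  rw [← map_sum]
  have h1 := sum_bilin_self (hY h) (yTensorAt₂ x hne) (x ⟨h, p⟩) (x ⟨h, q⟩)
  rw [h1, map_smul, yTensorAt₂_apply, yRep_inertiaTransp Y h hpq]

lemma sum_yRep_classFunction {c : Γ → ℂ} (hc : ∀ g γ : Γ, c (g * γ * g⁻¹) = c γ) (i : Pos n)
    (s : Finset Γ) (hs : ∀ g γ, g * γ * g⁻¹ ∈ s ↔ γ ∈ s) :
    ∑ γ ∈ s, c γ • yRep Y (inertiaEmbAt i γ) =
      ((∑ γ ∈ s, c γ * (Y i.1).character γ) / Module.finrank ℂ (V i.1)) • LinearMap.id := by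
  have := fun h => finiteDimensional_of_isIrreducible (hY h)
  refine ySpace_hom_ext fun x => ?_
  simp only [LinearMap.sum_apply, LinearMap.smul_apply, LinearMap.id_apply, yRep_inertiaEmbAt,
    ← yTensorAt_apply]
  have h1 := congrArg (yTensorAt x i) (sum_classFunction_apply (hY i.1) hc s hs (x i))
  simp only [map_sum, map_smul] at h1
  rw [h1, yTensorAt_apply, Function.update_eq_self]

end YSpace

/-! ### Induced representations -/

section Induction

variable {G H : Type*} [Group G] [Group H] (φ : G →* H) {A : Type*} [AddCommGroup A] [Module ℂ A]
  (ρ : Representation ℂ G A)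

lemma ind_apply_mk_one (s : G) (x : A) :
    Representation.ind φ ρ (φ s) (Representation.IndV.mk φ ρ 1 x) =
      Representation.IndV.mk φ ρ 1 (ρ s x) := by
  rw [Representation.ind_mk, one_mul]
  have h1 := Representation.Coinvariants.mk_self_apply
    (Representation.tprod ((Representation.leftRegular ℂ H).comp φ) ρ) s
    (MonoidAlgebra.single (φ s)⁻¹ 1 ⊗ₜ x)
  rw [Representation.tprod_apply, TensorProduct.map_tmul] at h1
  have h2 : ((Representation.leftRegular ℂ H).comp φ) s (MonoidAlgebra.single (φ s)⁻¹ 1) =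
      MonoidAlgebra.single (1 : H) (1 : ℂ) := by
    simp
  rw [h2] at h1
  exact h1.symm

/-- A left inverse sends the class of `φ t ⊗ x` to `ρ t⁻¹ x` and kills `h ⊗ x` for `h` outside the
image of `φ`; this respects coinvariants, and injectivity of `φ` makes `t` unique. -/
lemma indMk_one_injective (hφ : Function.Injective φ) :
    Function.Injective (Representation.IndV.mk φ ρ 1) := by
  classical
  let e : H → A →ₗ[ℂ] A := fun h => if hh : ∃ t, φ t = h then ρ hh.choose⁻¹ else 0
  have he : ∀ t, e (φ t) = ρ t⁻¹ := by
    intro t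
    have hh : ∃ t', φ t' = φ t := ⟨t, rfl⟩
    simp only [e, dif_pos hh]
    rw [hφ hh.choose_spec]
  have he' : ∀ s h x, e (φ s * h) (ρ s x) = e h x := by
    intro s h x
    by_cases hh : ∃ t, φ t = h
    · obtain ⟨t, rfl⟩ := hh
      rw [← map_mul, he, he, ← Module.End.mul_apply, ← map_mul, mul_inv_rev, inv_mul_cancel_right]
    · have hh' : ¬∃ t, φ t = φ s * h := by
        rintro ⟨t, ht⟩
        exact hh ⟨s⁻¹ * t, by rw [map_mul, ht, map_inv, inv_mul_cancel_left]⟩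
      simp only [e, dif_neg hh, dif_neg hh', LinearMap.zero_apply]
  let L : Representation.IndV φ ρ →ₗ[ℂ] A := Representation.Coinvariants.lift _
    (TensorProduct.lift <| (Finsupp.lift _ _ _ e) ∘ₗ
      (MonoidAlgebra.coeffLinearEquiv ℂ).toLinearMap)
    fun s => by
      ext h x
      simp [he']
  refine Function.LeftInverse.injective (g := L) fun x => ?_
  have h1 : e 1 = ρ 1 := by
    have := he 1
    rwa [map_one, inv_one] at this
  simp [L, h1]

end Induction

/-! ### The relations on the induced representation -/

section R1

variable {Γ : Type} [Group Γ] {ν : ℕ} {n : Fin ν → ℕ}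

lemma inertiaFactorHom_injective : Function.Injective (inertiaFactorHom n) :=
  Perm.sigmaCongrRightHom_injective

lemma inertiaHom_injective : Function.Injective (inertiaHom Γ n) := by
  intro s t hst
  have h1 := congrArg SemidirectProduct.left hst
  have h2 := congrArg SemidirectProduct.right hst
  exact SemidirectProduct.ext h1 (inertiaFactorHom_injective h2)

lemma inertiaHom_embAt (i : Pos n) (γ : Γ) :
    inertiaHom Γ n (inertiaEmbAt i γ) = embAt i γ := by
  simp [inertiaHom, inertiaEmbAt, embAt]

lemma inertiaHom_transp (h : Fin ν) (p q : Fin (n h)) :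
    inertiaHom Γ n (inertiaTransp Γ h p q) = transp ⟨h, p⟩ ⟨h, q⟩ := by
  have : inertiaFactorHom n (Pi.mulSingle h (swap p q)) = swap ⟨h, p⟩ ⟨h, q⟩ := by
    ext1 ⟨h', r⟩
    change (⟨h', (Pi.mulSingle h (swap p q) : InertiaFactor n) h' r⟩ : Pos n) = _
    by_cases hh : h' = h
    · subst hh
      rw [Pi.mulSingle_eq_same, swap_apply_def, swap_apply_def]
      simp only [Sigma.mk.injEq, heq_eq_eq, true_and]
      split_ifs <;> rfl
    · rw [Pi.mulSingle_eq_of_ne hh, Perm.one_apply, swap_apply_of_ne_of_ne]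
      · exact fun e => hh (congrArg Sigma.fst e)
      · exact fun e => hh (congrArg Sigma.fst e)
  simp [inertiaHom, inertiaTransp, transp, this]

section Conjugation

variable {I : Type} [DecidableEq I]

lemma inr_mul_embAt (σ : Perm I) (i : I) (γ : Γ) :
    (SemidirectProduct.inr σ : Wreath Γ I) * embAt i γ =
      embAt (σ i) γ * SemidirectProduct.inr σ := by
  have h1 : (mulAutArrow σ : MulAut (I → Γ)) (Pi.mulSingle i γ) = Pi.mulSingle (σ i) γ := by
    funext j
    change (Pi.mulSingle i γ : I → Γ) (σ⁻¹ • j) = _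
    by_cases hj : j = σ i
    · subst hj
      simp
    · rw [Pi.mulSingle_eq_of_ne hj, Pi.mulSingle_eq_of_ne]
      intro e
      apply hj
      rw [← e]
      exact (σ.apply_symm_apply j).symm
  rw [embAt, embAt, ← h1, SemidirectProduct.inl_aut,
    mul_assoc _ _ (SemidirectProduct.inr σ), ← map_mul, inv_mul_cancel, map_one, mul_one]

lemma inr_mul_transp (σ : Perm I) (i j : I) :
    (SemidirectProduct.inr σ : Wreath Γ I) * transp i j =
      transp (σ i) (σ j) * SemidirectProduct.inr σ := by
  rw [transp, transp, ← map_mul, ← map_mul, swap_apply_apply, inv_mul_cancel_right]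

lemma inr_mul_term (σ : Perm I) (i j : I) (γ : Γ) :
    (SemidirectProduct.inr σ : Wreath Γ I) * (transp i j * embAt i γ * (embAt j γ)⁻¹) =
      transp (σ i) (σ j) * embAt (σ i) γ * (embAt (σ j) γ)⁻¹ * SemidirectProduct.inr σ := by
  have h1 : (SemidirectProduct.inr σ : Wreath Γ I) * (embAt j γ)⁻¹ =
      (embAt (σ j) γ)⁻¹ * SemidirectProduct.inr σ := by
    rw [eq_inv_mul_iff_mul_eq, ← mul_assoc, ← inr_mul_embAt, mul_inv_cancel_right]
  rw [mul_assoc, ← mul_assoc (SemidirectProduct.inr σ), inr_mul_transp, mul_assoc,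
    ← mul_assoc (SemidirectProduct.inr σ), inr_mul_embAt, mul_assoc, h1]
  simp only [mul_assoc]

open Classical in
/-- The operator of the relation at `i`. -/
def relationOp [Fintype Γ] [Fintype I] {M : Type*} [AddCommGroup M] [Module ℂ M]
    (ρ : Representation ℂ (Wreath Γ I) M) (k : ℂ) (c : Γ → ℂ) (i : I) : Module.End ℂ M :=
  1 + (k / 2) • (∑ j ∈ Finset.univ.filter (fun j : I => j ≠ i), ∑ γ : Γ,
          ρ (transp i j * embAt i γ * (embAt j γ)⁻¹))
      + ∑ γ ∈ Finset.univ.filter (fun γ : Γ => γ ≠ 1), c γ • ρ (embAt i γ)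

lemma satisfiesR1_iff [Fintype Γ] [Fintype I] {M : Type*} [AddCommGroup M] [Module ℂ M]
    (ρ : Representation ℂ (Wreath Γ I) M) (k : ℂ) (c : Γ → ℂ) :
    SatisfiesR1 ρ k c ↔ ∀ i, relationOp ρ k c i = 0 :=
  forall_congr' fun _ => eq_comm

/-- Conjugation by a permutation carries the relation at `i` to the relation at `σ i`, so vanishing
on `W ⊗ Y` spreads to its translates. -/
lemma rho_inr_mul_relationOp [Fintype Γ] [Fintype I] {M : Type*} [AddCommGroup M] [Module ℂ M]
    (ρ : Representation ℂ (Wreath Γ I) M) (k : ℂ) (c : Γ → ℂ) (σ : Perm I) (i : I) :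
    ρ (SemidirectProduct.inr σ) * relationOp ρ k c i =
      relationOp ρ k c (σ i) * ρ (SemidirectProduct.inr σ) := by
  classical
  simp only [relationOp, mul_add, add_mul, mul_one, one_mul, mul_smul_comm, smul_mul_assoc,
    Finset.mul_sum, Finset.sum_mul, ← map_mul, inr_mul_term, inr_mul_embAt]
  congr 3
  refine Finset.sum_equiv σ (fun j => ?_) fun _ _ => rfl
  simp

end Conjugation

variable {V : Fin ν → Type*} [∀ h, AddCommGroup (V h)] [∀ h, Module ℂ (V h)]
  {U : Type*} [AddCommGroup U] [Module ℂ U] (W : Representation ℂ (InertiaFactor n) U)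
  (Y : ∀ h, Representation ℂ Γ (V h))

/-- The embedding of `W ⊗ Y` in the induced representation. -/
abbrev wyMk : U ⊗[ℂ] YSpace n V →ₗ[ℂ] Representation.IndV (inertiaHom Γ n) (wyRep W Y) :=
  Representation.IndV.mk (inertiaHom Γ n) (wyRep W Y) 1

lemma wyInd_wyMk (s : Inertia Γ n) (u : U) (y : YSpace n V) :
    wyInd W Y (inertiaHom Γ n s) (wyMk W Y (u ⊗ₜ y)) =
      wyMk W Y (W s.right u ⊗ₜ yRep Y s y) :=
  ind_apply_mk_one _ _ s _

variable [Fintype Γ]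

open Classical in
/-- The scalar `dim Y + ∑_{γ ≠ 1} c_γ χ_Y(γ)`. -/
def levelScalar {Γ : Type} [Group Γ] [Fintype Γ] {V : Type*} [AddCommGroup V] [Module ℂ V]
    (Y : Representation ℂ Γ V) (c : Γ → ℂ) : ℂ :=
  (Module.finrank ℂ V : ℂ) +
    ∑ γ ∈ Finset.univ.filter (fun γ : Γ => γ ≠ 1), c γ * Y.character γ

/-- The relations hold as soon as they hold on `W ⊗ Y`. -/
lemma satisfiesR1_wyInd_iff (k : ℂ) (c : Γ → ℂ) :
    SatisfiesR1 (wyInd W Y) k c ↔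
      ∀ i u y, relationOp (wyInd W Y) k c i (wyMk W Y (u ⊗ₜ y)) = 0 := by
  rw [satisfiesR1_iff]
  constructor
  · intro h i u y
    rw [h i, LinearMap.zero_apply]
  · intro h i
    have h0 : ∀ i x, relationOp (wyInd W Y) k c i (wyMk W Y x) = 0 := by
      intro i x
      induction x using TensorProduct.induction_on with
      | zero => rw [map_zero, map_zero]
      | tmul u y => exact h i u y
      | add x x' hx hx' => rw [map_add, map_add, hx, hx', add_zero]
    refine Representation.IndV.hom_ext _ _ fun g => LinearMap.ext fun x => ?_
    change relationOp (wyInd W Y) k c i (Representation.IndV.mk _ _ g x) = 0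
    have h1 : Representation.IndV.mk (inertiaHom Γ n) (wyRep W Y) g x =
        wyInd W Y g⁻¹ (wyMk W Y x) := by
      rw [wyInd, Representation.ind_mk, inv_inv, one_mul]
    -- The `Γ^N` part lies in the inertia group and preserves `W ⊗ Y`; only the permutation has to
    -- be moved past the relation operator.
    have h2 : g⁻¹ = SemidirectProduct.inr (g.right⁻¹) *
        inertiaHom Γ n (SemidirectProduct.inl g.left⁻¹) := by
      have h3 := SemidirectProduct.inl_left_mul_inr_right g
      conv_lhs => rw [← h3]
      rw [mul_inv_rev, ← map_inv, ← map_inv, inertiaHom, SemidirectProduct.map_inl,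
        MonoidHom.id_apply]
    obtain ⟨i', rfl⟩ : ∃ i', i = g.right⁻¹ i' := ⟨g.right i, by simp⟩
    rw [h1, h2, map_mul, Module.End.mul_apply, ← Module.End.mul_apply (relationOp _ _ _ _),
      ← rho_inr_mul_relationOp, Module.End.mul_apply]
    have h4 : wyInd W Y (inertiaHom Γ n (SemidirectProduct.inl g.left⁻¹)) (wyMk W Y x) =
        wyMk W Y (wyRep W Y (SemidirectProduct.inl g.left⁻¹) x) := ind_apply_mk_one _ _ _ _
    rw [h4, h0, map_zero]

variable (hY : ∀ h, (Y h).IsIrreducible)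
  (hYne : ∀ h h', h ≠ h' → IsEmpty ((Y h).Equiv (Y h')))

include hY hYne

open Classical in
lemma relationOp_wyMk (k : ℂ) {c : Γ → ℂ} (hc : ∀ g γ : Γ, c (g * γ * g⁻¹) = c γ) (h : Fin ν)
    (p : Fin (n h)) (u : U) (y : YSpace n V) :
    relationOp (wyInd W Y) k c ⟨h, p⟩ (wyMk W Y (u ⊗ₜ y)) =
      wyMk W Y ((u + (k / 2 * (Fintype.card Γ / Module.finrank ℂ (V h))) •
        (∑ q ∈ Finset.univ.erase p, blockRep W h (swap p q) u) +
        ((∑ γ ∈ Finset.univ.filter (fun γ : Γ => γ ≠ 1), c γ * (Y h).character γ) /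
          Module.finrank ℂ (V h)) • u) ⊗ₜ y) := by
  have h1 : ∑ γ ∈ Finset.univ.filter (fun γ : Γ => γ ≠ 1),
      c γ • wyInd W Y (embAt ⟨h, p⟩ γ) (wyMk W Y (u ⊗ₜ y)) =
      wyMk W Y ((((∑ γ ∈ Finset.univ.filter (fun γ : Γ => γ ≠ 1), c γ * (Y h).character γ) /
          Module.finrank ℂ (V h)) • u) ⊗ₜ y) := by
    have h2 := congrArg (fun f => f y) (sum_yRep_classFunction Y hY hc ⟨h, p⟩
      (Finset.univ.filter fun γ : Γ => γ ≠ 1) (by simp))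
    simp only [LinearMap.sum_apply, LinearMap.smul_apply, LinearMap.id_apply] at h2
    rw [TensorProduct.smul_tmul, ← h2, TensorProduct.tmul_sum, map_sum]
    refine Finset.sum_congr rfl fun γ _ => ?_
    rw [← inertiaHom_embAt, wyInd_wyMk, TensorProduct.tmul_smul, map_smul]
    congr 3
    simp [inertiaEmbAt]
  have h3 : ∀ q, q ≠ p → ∑ γ : Γ, wyInd W Y (transp ⟨h, p⟩ ⟨h, q⟩ * embAt ⟨h, p⟩ γ *
      (embAt ⟨h, q⟩ γ)⁻¹) (wyMk W Y (u ⊗ₜ y)) =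
      ((Fintype.card Γ : ℂ) / Module.finrank ℂ (V h)) •
        wyMk W Y (blockRep W h (swap p q) u ⊗ₜ y) := by
    intro q hq
    have h4 := congrArg (fun f => f y) (sum_yRep_block Y hY h hq.symm)
    simp only [LinearMap.sum_apply, LinearMap.smul_apply, LinearMap.id_apply] at h4
    rw [← map_smul, ← TensorProduct.tmul_smul, ← h4, TensorProduct.tmul_sum, map_sum]
    refine Finset.sum_congr rfl fun γ _ => ?_
    rw [← inertiaHom_embAt, ← inertiaHom_embAt, ← inertiaHom_transp, ← map_inv, ← map_mul,
      ← map_mul, wyInd_wyMk]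
    congr 3
  have h5 : ∀ j : Pos n, j.1 ≠ h → ∑ γ : Γ, wyInd W Y (transp ⟨h, p⟩ j * embAt ⟨h, p⟩ γ *
      (embAt j γ)⁻¹) (wyMk W Y (u ⊗ₜ y)) = 0 := by
    intro j hj
    have h4 := congrArg (fun f => f y) (sum_yRep_of_ne Y hY hYne (i := ⟨h, p⟩) (j := j) hj.symm)
    simp only [LinearMap.sum_apply, LinearMap.zero_apply] at h4
    -- For positions in different blocks the transposition lies outside the inertia group, so it is
    -- pulled out in front; the sum over `γ` already vanishes before it acts.
    have h6 : ∀ γ : Γ, wyInd W Y (transp ⟨h, p⟩ j * embAt ⟨h, p⟩ γ * (embAt j γ)⁻¹)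
        (wyMk W Y (u ⊗ₜ y)) = wyInd W Y (transp ⟨h, p⟩ j) (wyMk W Y (u ⊗ₜ
          yRep Y (inertiaEmbAt ⟨h, p⟩ γ * (inertiaEmbAt j γ)⁻¹) y)) := by
      intro γ
      rw [mul_assoc, map_mul, Module.End.mul_apply, ← inertiaHom_embAt, ← inertiaHom_embAt,
        ← map_inv, ← map_mul, wyInd_wyMk]
      congr 4
      simp [inertiaEmbAt]
    simp only [h6]
    rw [← map_sum, ← map_sum, ← TensorProduct.tmul_sum, h4, TensorProduct.tmul_zero, map_zero,
      map_zero]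
  have h7 : ∑ j ∈ Finset.univ.filter (fun j : Pos n => j ≠ ⟨h, p⟩), ∑ γ : Γ,
      wyInd W Y (transp ⟨h, p⟩ j * embAt ⟨h, p⟩ γ * (embAt j γ)⁻¹) (wyMk W Y (u ⊗ₜ y)) =
      ((Fintype.card Γ : ℂ) / Module.finrank ℂ (V h)) •
        wyMk W Y ((∑ q ∈ Finset.univ.erase p, blockRep W h (swap p q) u) ⊗ₜ y) := by
    rw [← Finset.sum_subset (s₁ := (Finset.univ.erase p).map (Function.Embedding.sigmaMk h)),
      Finset.sum_map, TensorProduct.sum_tmul, map_sum, Finset.smul_sum]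
    · exact Finset.sum_congr rfl fun q hq => h3 q (Finset.ne_of_mem_erase hq)
    · intro j hj
      obtain ⟨q, hq, rfl⟩ := Finset.mem_map.1 hj
      simpa using hq
    · rintro ⟨h', q⟩ hj hj'
      refine h5 _ fun hh => hj' ?_
      change h' = h at hh
      subst hh
      refine Finset.mem_map.2 ⟨q, ?_, rfl⟩
      simpa using hj
  simp only [relationOp, LinearMap.add_apply, LinearMap.smul_apply, LinearMap.sum_apply,
    Module.End.one_apply]
  rw [h1, h7, TensorProduct.add_tmul, TensorProduct.add_tmul, map_add, map_add, smul_smul,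
    ← map_smul, TensorProduct.smul_tmul']

/-- The relations in terms of the transpositions in each block. -/
lemma satisfiesR1_wyInd_iff_block (k : ℂ) {c : Γ → ℂ} (hc : ∀ g γ : Γ, c (g * γ * g⁻¹) = c γ) :
    SatisfiesR1 (wyInd W Y) k c ↔
      ∀ (h : Fin ν) (p : Fin (n h)) (u : U), levelScalar (Y h) c • u +
        (k / 2 * Fintype.card Γ) •
          ∑ q ∈ Finset.univ.erase p, blockRep W h (swap p q) u = 0 := by
  classical
  have hnt := fun h => nontrivial_of_isIrreducible (hY h)
  rw [satisfiesR1_wyInd_iff]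
  have key : ∀ (h : Fin ν) (p : Fin (n h)) (u : U),
      (∀ y, relationOp (wyInd W Y) k c ⟨h, p⟩ (wyMk W Y (u ⊗ₜ y)) = 0) ↔
        levelScalar (Y h) c • u +
        (k / 2 * Fintype.card Γ) •
          ∑ q ∈ Finset.univ.erase p, blockRep W h (swap p q) u = 0 := by
    intro h p u
    have hd := finrank_ne_zero_of_isIrreducible (hY h)
    rw [levelScalar]
    set d : ℂ := (Module.finrank ℂ (V h) : ℂ) with hd'
    set S := ∑ γ ∈ Finset.univ.filter (fun γ : Γ => γ ≠ 1), c γ * (Y h).character γ with hS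
    set X := ∑ q ∈ Finset.univ.erase p, blockRep W h (swap p q) u with hX
    have h1 : u + (k / 2 * (Fintype.card Γ / d)) • X + (S / d) • u =
        d⁻¹ • ((d + S) • u + (k / 2 * Fintype.card Γ) • X) := by
      rw [smul_add, smul_smul, smul_smul, mul_add, inv_mul_cancel₀ hd, add_smul, one_smul]
      rw [show d⁻¹ * S = S / d by ring, show d⁻¹ * (k / 2 * Fintype.card Γ) =
        k / 2 * (Fintype.card Γ / d) by ring]
      abel
    have h2 : ∀ y, relationOp (wyInd W Y) k c ⟨h, p⟩ (wyMk W Y (u ⊗ₜ y)) =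
        wyMk W Y ((d⁻¹ • ((d + S) • u + (k / 2 * Fintype.card Γ) • X)) ⊗ₜ y) := by
      intro y
      rw [relationOp_wyMk W Y hY hYne k hc h p u y, ← h1]
    simp only [h2]
    constructor
    · intro h3
      have := nontrivial_ySpace (n := n) (V := V)
      -- Contracting with a functional nonzero on `y` recovers the identity in `U` from the one in
      -- `U ⊗ Y`.
      obtain ⟨y, hy⟩ := exists_ne (0 : YSpace n V)
      obtain ⟨f, hf⟩ := exists_dual_apply_ne_zero hy
      have h4 := indMk_one_injective _ (wyRep W Y) inertiaHom_injective
        ((h3 y).trans (map_zero _).symm)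
      have h5 := congrArg (fun t => TensorProduct.rid ℂ U (LinearMap.lTensor U f t)) h4
      simp only [LinearMap.lTensor_tmul, TensorProduct.rid_tmul, map_zero] at h5
      exact (smul_eq_zero.1 ((smul_eq_zero.1 h5).resolve_left hf)).resolve_left (inv_ne_zero hd)
    · intro h3 y
      rw [h3, smul_zero, TensorProduct.zero_tmul, map_zero]
  constructor
  · intro H h p u
    exact (key h p u).1 fun y => H ⟨h, p⟩ u y
  · rintro H ⟨h, p⟩ u y
    exact (key h p u).2 (H h p u) y

end R1

open Classical in
/-- The sum over the conjugacy classes as a sum over the group. -/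
lemma onHyperplane_iff {Γ : Type} [Group Γ] [Fintype Γ] {V : Type*}
    [AddCommGroup V] [Module ℂ V]
    (Y : Representation ℂ Γ V) (a b : ℕ) (k : ℂ) {c : Γ → ℂ}
    (hc : ∀ g γ : Γ, c (g * γ * g⁻¹) = c γ) :
    OnHyperplane Y a b k c ↔ levelScalar Y c +
        (k / 2 * Fintype.card Γ) * ((b : ℂ) - a) = 0 := by
  have hchar : ∀ g γ : Γ, Y.character (g * γ * g⁻¹) = Y.character γ := fun g γ => by
    rw [Representation.character, Representation.character, map_mul, LinearMap.trace_mul_comm,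
      ← map_mul, ← mul_assoc, inv_mul_cancel, one_mul]
  have h1 : ∀ γ : Γ, c (Quotient.out (ConjClasses.mk γ)) *
      Y.character (Quotient.out (ConjClasses.mk γ)) = c γ * Y.character γ := by
    intro γ
    have h2 : ConjClasses.mk (Quotient.out (ConjClasses.mk γ)) = ConjClasses.mk γ :=
      Quotient.out_eq _
    obtain ⟨g, hg⟩ := isConj_iff.1 (ConjClasses.mk_eq_mk_iff_isConj.1 h2)
    generalize Quotient.out (ConjClasses.mk γ) = t at hg ⊢
    rw [← hg, hc, hchar]
  have h3 : ∑ γ ∈ Finset.univ.filter (fun γ : Γ => γ ≠ 1), c γ * Y.character γ =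
      ∑ C ∈ Finset.univ.filter (fun C : ConjClasses Γ => C ≠ ConjClasses.mk 1),
        c (Quotient.out C) * (Nat.card C.carrier : ℂ) * Y.character (Quotient.out C) := by
    rw [← Finset.sum_fiberwise_of_maps_to (g := ConjClasses.mk)
      (t := Finset.univ.filter fun C : ConjClasses Γ => C ≠ ConjClasses.mk 1)]
    · refine Finset.sum_congr rfl fun C hC => ?_
      have h4 : ((Finset.univ.filter fun γ : Γ => γ ≠ 1).filter fun γ => ConjClasses.mk γ = C) =
          C.carrier.toFinset := by
        ext γ
        simp only [Finset.mem_filter, Finset.mem_univ, true_and, Set.mem_toFinset,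
          ConjClasses.mem_carrier_iff_mk_eq, and_iff_right_iff_imp]
        rintro rfl rfl
        exact (Finset.mem_filter.1 hC).2 rfl
      rw [h4, Nat.card_eq_card_toFinset, mul_right_comm, mul_comm _ (_ : ℂ), ← nsmul_eq_mul,
        ← Finset.sum_const]
      refine Finset.sum_congr rfl fun γ hγ => ?_
      rw [← h1, ConjClasses.mem_carrier_iff_mk_eq.1 (Set.mem_toFinset.1 hγ)]
    · intro γ hγ
      refine Finset.mem_filter.2 ⟨Finset.mem_univ _, fun e => (Finset.mem_filter.1 hγ).2 ?_⟩
      exact (isConj_one_right.1 (ConjClasses.mk_eq_mk_iff_isConj.1 e.symm))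
  rw [levelScalar, h3, OnHyperplane]
  constructor
  · intro h
    linear_combination h
  · intro h
    linear_combination h

end WreathR1

end

/-! ### The main theorem -/

open WreathR1 in
theorem proposition4p4
    (Γ : Subgroup (Matrix.SpecialLinearGroup (Fin 2) ℂ)) [Fintype Γ]
    -- pairwise non-isomorphic irreducible representations of `Γ`
    {ν : ℕ} {V : Fin ν → Type*} [∀ h, AddCommGroup (V h)] [∀ h, Module ℂ (V h)]
    (Y : ∀ h, Representation ℂ Γ (V h))
    (hY : ∀ h, (Y h).IsIrreducible)
    (hYne : ∀ h h', h ≠ h' → IsEmpty ((Y h).Equiv (Y h')))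
    -- a non-trivial type
    (n : Fin ν → ℕ) (hn : ∃ h h', h ≠ h' ∧ n h ≠ 0 ∧ n h' ≠ 0)
    -- an irreducible representation of the inertia factor
    {U : Type*} [AddCommGroup U] [Module ℂ U]
    (W : Representation ℂ (WreathR1.InertiaFactor n) U) (hW : W.IsIrreducible)
    -- the parameters
    (k : ℂ) (hk : k ≠ 0) (c : Γ → ℂ) (hc : ∀ g γ : Γ, c (g * γ * g⁻¹) = c γ) :
    WreathR1.SatisfiesR1 (WreathR1.wyInd W Y) k c ↔
      ∃ (a b : Fin ν → ℕ)
        (T : ∀ h, Fin (n h) ≃ {x // x ∈ (WreathR1.rectDiagram (a h) (b h)).cells}),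
        Nonempty (W.Equiv (WreathR1.extTensor fun h => WreathR1.spechtRep (T h))) ∧
        ∀ h, n h ≠ 0 → WreathR1.OnHyperplane (Y h) (a h) (b h) k c := by
  classical
  have := nontrivial_of_isIrreducible hW
  rw [satisfiesR1_wyInd_iff_block W Y hY hYne k hc]
  have hkΓ : k / 2 * (Fintype.card Γ : ℂ) ≠ 0 :=
    mul_ne_zero (div_ne_zero hk two_ne_zero) (by exact_mod_cast Fintype.card_ne_zero)
  constructor
  · intro H
    -- Here `k ≠ 0` is essential: dividing by `(k/2)|Γ|` turns the relation into a statement about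
    -- sums of transpositions.
    have hscalar : ∀ h u, SwapSumsActBy (blockRep W h) Finset.univ
        (-(levelScalar (Y h) c / (k / 2 * (Fintype.card Γ : ℂ)))) u := by
      intro h u p _
      have h1 := congrArg ((k / 2 * (Fintype.card Γ : ℂ))⁻¹ • ·) (H h p u)
      simp only [smul_add, smul_zero, smul_smul, inv_mul_cancel₀ hkΓ, one_smul] at h1
      rw [eq_neg_of_add_eq_zero_right h1, neg_smul, div_eq_inv_mul (levelScalar (Y h) c)]
    choose a b hab hl using fun h => exists_rectangle (hscalar h)
    have hT : ∀ h, Nonempty (Fin (n h) ≃ {x // x ∈ (rectDiagram (a h) (b h)).cells}) := by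
      intro h
      rw [← Fintype.card_eq, ← hab, Fintype.card_coe]
      simp [rectDiagram]
    refine ⟨a, b, fun h => (hT h).some, nonempty_equiv_extTensor W _ hW fun h u p hp => ?_,
      fun h hh => ?_⟩
    · rw [← hl h ⟨p⟩]
      exact hscalar h u p hp
    -- A nonempty block identifies the scalar with `b - a`, and the hyperplane equation is then the
    -- definition of that scalar.
    · rw [onHyperplane_iff _ _ _ _ hc, ← hl h ⟨⟨0, Nat.pos_of_ne_zero hh⟩⟩]
      field_simp
      ring
  · rintro ⟨a, b, T, ⟨φ⟩, hab⟩ h p u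
    have h1 := (onHyperplane_iff _ _ _ _ hc).1
      (hab h (Nat.pos_iff_ne_zero.1 ((Nat.zero_le _).trans_lt p.2)))
    rw [swapSumsActBy_of_equiv W T φ h u p (Finset.mem_univ p), smul_smul, ← add_smul, h1,
      zero_smul]
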